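/- All graphs are simple, undirected and finite. For a nonnegative integer valued graph parameter $\beta$ and positive integers $r,n$, an $r$-decomposition of $K_n=([n],E)$ is a partition of $E$ into the edge sets of $r$ spanning subgraphs $G_1,\dots,G_r$ of $K_n$ (some of which may have no edge), and $$\overline{\mathrm{NG}}_\beta(r;n):=\max\{\beta(G_1)+\dots+\beta(G_r) : G_1,\dots,G_r \text{ an } r\text{-decomposition of } K_n\}.$$ Parameters. The Hadwiger number $\eta(G)$ is the maximum order of a clique minor of $G$. The tree-width $\mathrm{tw}(G)$, largeur d'arborescence $\mathrm{la}(G)$, path-width $\mathrm{pw}(G)$ and proper path-width $\mathrm{ppw}(G)$ are $0$ if $G$ has no edge, and otherwise the least $k\ge 1$ for which $G$ is a subgraph of a $k$-tree, a two-sided $k$-tree, a $k$-caterpillar, a linear $k$-tree, respectively. All of these are constructed by starting with $K_{k+1}$ and adding vertices one at a time, connecting each new vertex to the vertices of an existing $k$-clique; for a $k$-tree this clique is arbitrary; for a two-sided $k$-tree it must include a vertex that has degree $k$ at that stage or be a $k$-clique to which some previous vertex was connected; for a $k$-caterpillar it must be contained in the $(k+1)$-clique added in the previous step (initially the starting $K_{k+1}$);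 for a linear $k$-tree it must include the vertex added in the previous step (if there was a previous step). For a graph $G$ on $[n]$ let $\mathcal S(G)$ be the set of real symmetric $n\times n$ matrices $A=[a_{ij}]$ such that, for all $i\ne j$, $a_{ij}\neq 0$ if and only if $ij$ is an edge of $G$. A real symmetric matrix $A$ has the Strong Arnold Property if there is no nonzero real symmetric $X$ with $AX=O$, $A\circ X=O$ and $I\circ X=O$, where $\circ$ is the entrywise product. Then $\xi(G)$ is the maximum nullity of a matrix $A\in\mathcal S(G)$ with the Strong Arnold Property; $\nu(G)$ is the maximum nullity of a positive semidefinite such $A$; and $\mu(G)$ is the maximum nullity of such an $A$ that has exactly one negative eigenvalue (counted with multiplicity) and satisfies $a_{ij}\le 0$ for all $i\neq j$. Theorem. Fix an integer $r\ge 2$. (a) For each $\beta\in\{\mathrm{tw},\mathrm{la},\mathrm{pw},\mathrm{ppw}\}$, $$\lim_{n\to\infty}\frac{\overline{\mathrm{NG}}_\beta(r;n)}{n}=r.$$ (b) For each $\beta\in\{\eta,\mu,\nu,\xi\}$, $\overline{\mathrm{NG}}_\beta(r;n)=\Theta(n)$ as $n\to\infty$. Specifically, for $n\ge 3$, as $n\to\infty$,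 $$\frac{r}{\left\lceil\sqrt{2r+\tfrac14}-\tfrac12\right\rceil}-o(1)\;\le\;\frac{\overline{\mathrm{NG}}_\beta(r;n)}{n}\;\le\;\sqrt r+o(1),$$ where $o(1)$ denotes a real function of $n$ that tends to $0$. -/

import Mathlib

open Filter Topology Asymptotics
open scoped Matrix

/-- A nonnegative integer valued graph parameter, on the graphs with vertex set `[n] = Fin n`. -/
abbrev GraphParameter : Type := ∀ n : ℕ, SimpleGraph (Fin n) → ℕ

namespace NG

/-! ### Decompositions of the complete graph and the sum upper bound -/

/-- `G 0, …, G (r-1)` is an `r`-decomposition of the complete graph on `Fin n`: the spanning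
subgraphs `G i` (some of which may have no edge) partition the edges. -/
structure IsDecomposition {r n : ℕ} (G : Fin r → SimpleGraph (Fin n)) : Prop where
  disjoint : Pairwise fun i j => Disjoint (G i).edgeSet (G j).edgeSet
  union : ⋃ i, (G i).edgeSet = (⊤ : SimpleGraph (Fin n)).edgeSet

/-- The Nordhaus-Gaddum sum upper bound: the maximum of `β (G 0) + … + β (G (r-1))` over all
`r`-decompositions. There are finitely many of these (and at least one if `r` is positive), so the
supremum is a maximum. -/
noncomputable def sumUpper (β : GraphParameter) (r n : ℕ) : ℕ :=
  sSup {s | ∃ G : Fin r → SimpleGraph (Fin n), IsDecomposition G ∧ s = ∑ i, β n (G i)}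

/-! ### Tree-width and its variants

A construction that adds the vertices of a graph one at a time is recorded by numbering the vertices
in the order in which they are added. -/

/-- The vertices to which `v` is connected at the moment when it is added. -/
def back {m : ℕ} (H : SimpleGraph (Fin m)) (v : Fin m) : Set (Fin m) :=
  {u | u < v ∧ H.Adj u v}

/-- `H`, its vertices being numbered in the order of construction, is a `k`-tree: the first `k + 1`
vertices form a complete graph, and each new vertex is connected to the vertices of an existing
clique on `k` vertices. -/
structure IsKTree (k : ℕ) {m : ℕ} (H : SimpleGraph (Fin m)) : Prop where
  size : k + 1 ≤ m
  start : ∀ u v : Fin m, u < v → v.val ≤ k → H.Adj u v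
  clique : ∀ v : Fin m, k < v.val → H.IsClique (back H v)
  card : ∀ v : Fin m, k < v.val → (back H v).ncard = k

/-- A two-sided `k`-tree: the `k`-clique to which a new vertex `v` is connected either includes a
vertex that has degree `k` in the graph constructed so far, or is the `k`-clique to which some
vertex was connected previously. -/
structure IsTwoSidedKTree (k : ℕ) {m : ℕ} (H : SimpleGraph (Fin m)) : Prop
    extends IsKTree k H where
  twoSided : ∀ v : Fin m, k < v.val →
    (∃ u ∈ back H v, {w : Fin m | w < v ∧ H.Adj u w}.ncard = k) ∨
    (∃ w : Fin m, k < w.val ∧ w < v ∧ back H w = back H v)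

/-- A `k`-caterpillar: each new vertex `v` is connected to a facet (a sub-clique on `k` vertices) of
the maximal clique added in the previous step, which consists of the previous vertex `u` and of
`back H u`. (For the first vertex after the initial complete graph this maximal clique is the
initial complete graph itself.) -/
structure IsKCaterpillar (k : ℕ) {m : ℕ} (H : SimpleGraph (Fin m)) : Prop
    extends IsKTree k H where
  facet : ∀ u v : Fin m, k < v.val → u.val + 1 = v.val → back H v ⊆ insert u (back H u)

/-- A linear `k`-tree: each new vertex `v` is connected to a facet that includes the vertex `u`
added in the previous step, if there was a previous step. -/
structure IsLinearKTree (k : ℕ) {m : ℕ} (H : SimpleGraph (Fin m)) : Prop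
    extends IsKTree k H where
  facet : ∀ u v : Fin m, k < u.val → u.val + 1 = v.val → u ∈ back H v

open Classical in
/-- The least `k ≥ 1` such that `G` is a subgraph of a member of the class `P k`, and `0` if `G` has
no edge. -/
noncomputable def width (P : ℕ → ∀ m : ℕ, SimpleGraph (Fin m) → Prop) : GraphParameter :=
  fun _ G => if G = ⊥ then 0 else
    sInf {k | 1 ≤ k ∧ ∃ (m : ℕ) (H : SimpleGraph (Fin m)), P k m H ∧ G.IsContained H}

/-- Tree-width `tw`. -/
noncomputable def treeWidth : GraphParameter := width fun k _ H => IsKTree k H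

/-- Largeur d'arborescence `la`. -/
noncomputable def largeurArborescence : GraphParameter := width fun k _ H => IsTwoSidedKTree k H

/-- Path-width `pw`. -/
noncomputable def pathWidth : GraphParameter := width fun k _ H => IsKCaterpillar k H

/-- Proper path-width `ppw`. -/
noncomputable def properPathWidth : GraphParameter := width fun k _ H => IsLinearKTree k H

/-! ### The Hadwiger number -/

/-- `H` is a minor of `G`: there are pairwise disjoint sets of vertices of `G`, one for each vertex
of `H`, that induce (nonempty) connected subgraphs, and such that `G` has an edge between the sets
of any two adjacent vertices of `H`. -/
def IsMinor {W V : Type*} (H : SimpleGraph W) (G : SimpleGraph V) : Prop :=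
  ∃ B : W → Set V,
    (∀ w, (G.induce (B w)).Connected) ∧
    (Pairwise fun w w' => Disjoint (B w) (B w')) ∧
    ∀ w w', H.Adj w w' → ∃ x ∈ B w, ∃ y ∈ B w', G.Adj x y

/-- The Hadwiger number `η`: the maximum order of a clique minor. -/
noncomputable def hadwiger : GraphParameter :=
  fun _ G => sSup {k | IsMinor (⊤ : SimpleGraph (Fin k)) G}

/-! ### Colin de Verdière type parameters -/

/-- `A` is a real symmetric matrix described by `G`; its diagonal is unrestricted. -/
structure IsDescribedBy {n : ℕ} (A : Matrix (Fin n) (Fin n) ℝ) (G : SimpleGraph (Fin n)) :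
    Prop where
  symm : A.IsSymm
  graph : ∀ i j, i ≠ j → (A i j ≠ 0 ↔ G.Adj i j)

/-- The Strong Arnold Property (`⊙` is the entrywise product). -/
def StrongArnold {n : ℕ} (A : Matrix (Fin n) (Fin n) ℝ) : Prop :=
  ¬ ∃ X : Matrix (Fin n) (Fin n) ℝ, X ≠ 0 ∧ X.IsSymm ∧ A * X = 0 ∧ A ⊙ X = 0 ∧
    (1 : Matrix (Fin n) (Fin n) ℝ) ⊙ X = 0

/-- The nullity of a square matrix. -/
noncomputable def nullity {n : ℕ} (A : Matrix (Fin n) (Fin n) ℝ) : ℕ :=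
  Module.finrank ℝ (LinearMap.ker A.mulVecLin)

/-- `A` has exactly one negative eigenvalue, counted with multiplicity. -/
def OneNegEigenvalue {n : ℕ} (A : Matrix (Fin n) (Fin n) ℝ) : Prop :=
  ∃ hA : A.IsHermitian, ∃! i, hA.eigenvalues i < 0

/-- The parameter `ξ`. -/
noncomputable def xi : GraphParameter := fun _ G =>
  sSup {k | ∃ A, IsDescribedBy A G ∧ StrongArnold A ∧ nullity A = k}

/-- The parameter `ν`. -/
noncomputable def nu : GraphParameter := fun _ G =>
  sSup {k | ∃ A, IsDescribedBy A G ∧ StrongArnold A ∧ A.PosSemidef ∧ nullity A = k}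

/-- The Colin de Verdière number `μ`. -/
noncomputable def mu : GraphParameter := fun _ G =>
  sSup {k | ∃ A, IsDescribedBy A G ∧ StrongArnold A ∧ OneNegEigenvalue A ∧
    (∀ i j, i ≠ j → A i j ≤ 0) ∧ nullity A = k}

end NG

/-! Part (a). Every width is at most `n`, because a complete graph on `k + 1` vertices belongs to
each class. Conversely, tree-width and hence all four widths are at least `n - 4 * s` when any two
disjoint sets of `s` vertices are joined by an edge: in the elimination forest of a `k`-tree, a
clique of size about `k` would otherwise leave two large sets with no edge between them
(`IsKTree.lt_of_isContained`). Counting colourings yields an `r`-colouring of the edges all of whose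
classes have this property with `s` of order `√n` (`exists_decomposition_hasNoGap`), so all `r`
widths are `n - o(n)` simultaneously.

Part (b), upper bound. A large value of the parameter costs edges: `β * (β - 1) ≤ 2 * n + 2 * e(G)`.
A clique minor needs an edge for each pair of branch sets (`IsMinor.mul_le_adjPairs`). For the
matrix parameters, the Strong Arnold Property embeds the symmetric forms on the kernel into the
functions on diagonal positions and edges (`nullity_mul_le`). Since the graphs share fewer than `n ^
2 / 2` edges when `n` is positive, Cauchy-Schwarz gives `√r * n + O(√n)` or better.

Part (b), lower bound. Let `q` be least with `r ≤ q + q.choose 2`, and split the vertices into `q`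
nearly equal classes. Of the `r` graphs, `q` contain a clique on one class and the others are
balanced complete bipartite graphs between two classes (`exists_decomposition_cliques_bicliques`).
Each has parameter at least about `n / q`. For `η` this is direct. For `μ`, `ν`, `ξ` a single matrix
family `gramShift` serves: its Schur complement on `U` is `τ J`, so the nullity is at least `|U| -
1`, while the sign of `τ` selects between a positive semidefinite matrix and one with a single
negative eigenvalue. -/

namespace NG

/-! ### Tree-width of graphs without large gaps -/

section Descendants

variable {k m : ℕ} {H : SimpleGraph (Fin m)}

open Classical in
/-- The largest vertex to which `v` is connected when it is added, and `v` if there is none. -/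
noncomputable def parent (H : SimpleGraph (Fin m)) (v : Fin m) : Fin m :=
  if h : (back H v).Nonempty then (back H v).toFinset.max' (by simpa using h) else v

theorem parent_mem {v : Fin m} (h : (back H v).Nonempty) : parent H v ∈ back H v := by
  classical
  unfold parent
  rw [dif_pos h]
  have := Finset.max'_mem (back H v).toFinset (by simpa using h)
  simpa only [Set.mem_toFinset] using this

theorem le_parent {u v : Fin m} (h : u ∈ back H v) : u ≤ parent H v := by
  classical
  unfold parent
  rw [dif_pos ⟨u, h⟩]
  exact Finset.le_max' _ _ (by simpa using h)

theorem parent_le (v : Fin m) : parent H v ≤ v := by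
  by_cases h : (back H v).Nonempty
  · exact (parent_mem h).1.le
  · unfold parent; rw [dif_neg h]

/-- The descendants of `v` in the forest given by the parents. -/
def descendants (H : SimpleGraph (Fin m)) (v : Fin m) : Set (Fin m) :=
  {w | Relation.ReflTransGen (fun a b => parent H a = b) w v}

theorem mem_descendants_self (v : Fin m) : v ∈ descendants H v := Relation.ReflTransGen.refl

theorem descendants_subset {u v : Fin m} (h : u ∈ descendants H v) :
    descendants H u ⊆ descendants H v := fun _ hw => Relation.ReflTransGen.trans hw h

theorem le_of_mem_descendants {v w : Fin m} (h : w ∈ descendants H v) : v ≤ w := by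
  induction h with
  | refl => exact le_rfl
  | tail _ h ih => exact h ▸ (parent_le _).trans ih

theorem mem_descendants_parent (v : Fin m) : v ∈ descendants H (parent H v) :=
  Relation.ReflTransGen.single rfl

theorem parent_mem_descendants {v w : Fin m} (h : w ∈ descendants H v) (hne : w ≠ v) :
    parent H w ∈ descendants H v := by
  rcases Relation.ReflTransGen.cases_head h with h | ⟨c, rfl, h⟩
  · exact absurd h hne
  · exact h

theorem exists_child {v w : Fin m} (h : w ∈ descendants H v) (hne : w ≠ v) :
    ∃ c, parent H c = v ∧ c ≠ v ∧ w ∈ descendants H c := by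
  induction h using Relation.ReflTransGen.head_induction_on with
  | refl => exact absurd rfl hne
  | @head a c hac hc ih =>
    by_cases hcv : c = v
    · exact ⟨a, hac.trans hcv, hne, mem_descendants_self a⟩
    · obtain ⟨d, h1, h2, h3⟩ := ih hcv
      exact ⟨d, h1, h2, Relation.ReflTransGen.head hac h3⟩

theorem mem_descendants_or {u v w : Fin m} (hu : w ∈ descendants H u) (hv : w ∈ descendants H v) :
    u ∈ descendants H v ∨ v ∈ descendants H u :=
  Relation.ReflTransGen.total_of_right_unique (fun _ _ _ h1 h2 => h1.symm.trans h2) hu hv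

/-- The ancestors of `w` form a chain. If one child of `v` lay strictly below another, its parent
`v` would too, although `v` is smaller than both children. -/
theorem eq_of_siblings {v c d w : Fin m} (hc : parent H c = v) (hcv : c ≠ v) (hd : parent H d = v)
    (hdv : d ≠ v) (hwc : w ∈ descendants H c) (hwd : w ∈ descendants H d) : c = d := by
  by_contra hne
  have hlt : ∀ e : Fin m, parent H e = v → e ≠ v → v < e := fun e he hev =>
    lt_of_le_of_ne (he ▸ parent_le e) hev.symm
  rcases mem_descendants_or hwc hwd with h | h
  · have := parent_mem_descendants h hne
    rw [hc] at this
    exact (le_of_mem_descendants this).not_gt (hlt d hd hdv)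
  · have := parent_mem_descendants h (Ne.symm hne)
    rw [hd] at this
    exact (le_of_mem_descendants this).not_gt (hlt c hc hcv)

/-- Both `u` and the parent of `w` lie in the clique `back H w`, so they coincide or are adjacent,
and induction climbs from `w` to its parent. -/
theorem mem_descendants_of_adj (hH : ∀ v, H.IsClique (back H v)) {u w : Fin m} (huw : u < w)
    (h : H.Adj u w) : w ∈ descendants H u := by
  induction w using WellFoundedLT.induction with
  | _ w ih =>
    have hu : u ∈ back H w := ⟨huw, h⟩
    have hp := parent_mem ⟨u, hu⟩
    by_cases hup : u = parent H w
    · exact hup ▸ mem_descendants_parent w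
    · have hlt : u < parent H w := lt_of_le_of_ne (le_parent hu) hup
      exact descendants_subset (ih _ hp.1 hlt (hH w hu hp hup)) (mem_descendants_parent w)

/-- This makes `back H v` a separator between the subtree of `v` and the rest. The outside neighbour
`u` is passed up from `w` to its parent, again through the clique `back H w`, until `v` is reached.
-/
theorem mem_back_of_adj_descendants (hH : ∀ v, H.IsClique (back H v)) {u v w : Fin m}
    (hw : w ∈ descendants H v) (hu : u ∉ descendants H v) (h : H.Adj u w) : u ∈ back H v := by
  induction w using WellFoundedLT.induction with
  | _ w ih =>
    have huw : u < w := by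
      rcases lt_trichotomy u w with h1 | h1 | h1
      · exact h1
      · exact absurd h1 h.ne
      · exact absurd (descendants_subset hw (mem_descendants_of_adj hH h1 h.symm)) hu
    by_cases hwv : w = v
    · exact hwv ▸ ⟨huw, h⟩
    · have hb : u ∈ back H w := ⟨huw, h⟩
      have hp := parent_mem ⟨u, hb⟩
      have hpd := parent_mem_descendants hw hwv
      have hup : u ≠ parent H w := fun h1 => hu (h1 ▸ hpd)
      exact ih _ hp.1 hpd (hH w hb hp hup)

theorem IsKTree.isClique_back (hT : IsKTree k H) (v : Fin m) : H.IsClique (back H v) := by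
  by_cases h : k < v.val
  · exact hT.clique v h
  · intro a ha b hb hab
    rcases lt_or_gt_of_ne hab with h1 | h1
    · exact hT.start a b h1 (by have := hb.1; simp only [Fin.lt_def] at this; omega)
    · exact (hT.start b a h1 (by have := ha.1; simp only [Fin.lt_def] at this; omega)).symm

theorem IsKTree.ncard_back_le (hT : IsKTree k H) (v : Fin m) : (back H v).ncard ≤ k := by
  by_cases h : k < v.val
  · exact (hT.card v h).le
  · calc (back H v).ncard ≤ (Set.Iio v).ncard := Set.ncard_le_ncard fun u hu => hu.1
      _ = v.val := by simp [Set.ncard_eq_toFinset_card']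
      _ ≤ k := by omega

end Descendants

/-- Among finitely many nonnegative integers, each less than `s`, with sum at least `s`, some have
a sum between `s` and `2 * s`. -/
theorem exists_subset_sum_between {ι : Type*} (f : ι → ℕ) (s : ℕ) (T : Finset ι)
    (hs : 0 < s)
    (hf : ∀ i ∈ T, f i < s) (hT : s ≤ ∑ i ∈ T, f i) :
    ∃ T' ⊆ T, s ≤ ∑ i ∈ T', f i ∧ ∑ i ∈ T', f i < 2 * s := by
  classical
  induction T using Finset.induction_on with
  | empty => exact ⟨∅, le_rfl, hT, by simpa using hs⟩
  | insert a T ha ih =>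
    by_cases h : s ≤ ∑ i ∈ T, f i
    · obtain ⟨T', h1, h2⟩ := ih (fun i hi => hf i (Finset.mem_insert_of_mem hi)) h
      exact ⟨T', h1.trans (Finset.subset_insert _ _), h2⟩
    · refine ⟨insert a T, le_rfl, hT, ?_⟩
      rw [Finset.sum_insert ha]
      have := hf a (Finset.mem_insert_self _ _)
      omega

/-- Any two disjoint sets of at least `s` vertices are joined by an edge. -/
def HasNoGap {V : Type*} (G : SimpleGraph V) (s : ℕ) : Prop :=
  ∀ A B : Set V, Disjoint A B → s ≤ A.ncard → s ≤ B.ncard → ∃ a ∈ A, ∃ b ∈ B, G.Adj a b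

/-- Take the last `v` whose subtree is still heavy. Deleting `v` and `back H v`, at most `k + 1`
vertices, leaves the outside part and the subtrees of the children of `v`, with no edges between
these pieces. The outside and each child subtree are light, and without a gap the child subtrees
together cannot be heavy either. -/
theorem IsKTree.lt_of_isContained {k m n s : ℕ} {H : SimpleGraph (Fin m)} (hT : IsKTree k H)
    (hk : 1 ≤ k) {G : SimpleGraph (Fin n)} (hGH : G.IsContained H) (hs : 0 < s) (hsn : s ≤ n)
    (hG : HasNoGap G s) : n < k + 4 * s := by
  classical
  obtain ⟨f⟩ := hGH
  have hf := f.injective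
  -- Only vertices of `H` that come from `G` count, since the host `H` may be much larger.
  set w : Set (Fin m) → ℕ := fun S => (f ⁻¹' S).ncard with hw
  have w_mono : ∀ {S T : Set (Fin m)}, S ⊆ T → w S ≤ w T := fun h =>
    Set.ncard_le_ncard (Set.preimage_mono h)
  have w_union : ∀ S T : Set (Fin m), w (S ∪ T) ≤ w S + w T := fun S T => by
    simp only [hw, Set.preimage_union]; exact Set.ncard_union_le _ _
  have w_le : ∀ S : Set (Fin m), w S ≤ S.ncard := fun S => by
    rw [hw]
    dsimp only
    rw [← Set.ncard_image_of_injective _ hf]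
    exact Set.ncard_le_ncard (Set.image_preimage_subset _ _)
  have w_univ : w Set.univ = n := by simp [hw, Set.ncard_univ]
  have gap : ∀ S T : Set (Fin m), Disjoint S T → s ≤ w S → s ≤ w T →
      ∃ a ∈ S, ∃ b ∈ T, H.Adj a b := fun S T h h1 h2 => by
    obtain ⟨a, ha, b, hb, hab⟩ := hG _ _ (h.preimage f) h1 h2
    exact ⟨f a, ha, f b, hb, f.toHom.map_adj hab⟩
  have hcl := hT.isClique_back
  have hm : 0 < m := by have := hT.size; omega
  -- the last vertex with at least `s` descendants
  have hroot : descendants H (⟨0, hm⟩ : Fin m) = Set.univ := by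
    refine Set.eq_univ_of_forall fun v => ?_
    induction v using WellFoundedLT.induction with
    | _ v ih =>
      by_cases hv : v = ⟨0, hm⟩
      · exact hv ▸ mem_descendants_self v
      · have hv0 : 0 < v.val := Nat.pos_of_ne_zero fun h => hv (Fin.ext h)
        have hne : (back H v).Nonempty := by
          by_cases hkv : k < v.val
          · exact Set.nonempty_of_ncard_ne_zero (by have := hT.card v hkv; omega)
          · exact ⟨⟨0, hm⟩, hv0, hT.start _ _ hv0 (by omega)⟩
        exact descendants_subset (ih _ (parent_mem hne).1) (mem_descendants_parent v)
  obtain ⟨v, hvs, hvmax⟩ : ∃ v, s ≤ w (descendants H v) ∧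
      ∀ u, v < u → w (descendants H u) < s := by
    have hne : (Finset.univ.filter fun v => s ≤ w (descendants H v)).Nonempty :=
      ⟨⟨0, hm⟩, by simpa [hroot, w_univ] using hsn⟩
    refine ⟨Finset.max' _ hne, (Finset.mem_filter.1 (Finset.max'_mem _ hne)).2, fun u hu => ?_⟩
    by_contra h
    exact (Finset.le_max' _ u (by simpa using h)).not_gt hu
  -- few vertices are neither descendants of `v` nor joined to one
  have hR : w (descendants H v ∪ back H v)ᶜ < s := by
    by_contra h
    obtain ⟨a, ha, b, hb, hab⟩ := gap (descendants H v) (descendants H v ∪ back H v)ᶜ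
      (Set.disjoint_left.2 fun x h1 h2 => h2 (Or.inl h1)) hvs (not_lt.1 h)
    exact hb (Or.inr (mem_back_of_adj_descendants hcl ha (fun h => hb (Or.inl h)) hab.symm))
  set T : Finset (Fin m) := Finset.univ.filter fun c => parent H c = v ∧ c ≠ v with hTdef
  have hTv : ∀ c ∈ T, parent H c = v ∧ c ≠ v := fun c hc => by simpa [hTdef] using hc
  have hsum : ∀ T' ⊆ T, w (⋃ c ∈ T', descendants H c) = ∑ c ∈ T', w (descendants H c) := by
    intro T'
    induction T' using Finset.induction_on with
    | empty => intro; simp [hw]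
    | insert a T' ha ih =>
      intro hsub
      have hsub' : T' ⊆ T := (Finset.subset_insert _ _).trans hsub
      have hdis : Disjoint (descendants H a) (⋃ c ∈ T', descendants H c) := by
        rw [Set.disjoint_left]
        intro x hx hx'
        simp only [Set.mem_iUnion] at hx'
        obtain ⟨c, hc, hxc⟩ := hx'
        obtain ⟨h1, h2⟩ := hTv a (hsub (Finset.mem_insert_self _ _))
        obtain ⟨h3, h4⟩ := hTv c (hsub' hc)
        exact ha (eq_of_siblings h1 h2 h3 h4 hx hxc ▸ hc)
      rw [Finset.sum_insert ha, Finset.set_biUnion_insert, ← ih hsub']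
      simp only [hw, Set.preimage_union]
      exact Set.ncard_union_eq (hdis.preimage f)
  have hcover : (Set.univ : Set (Fin m)) ⊆
      ((((⋃ c ∈ T, descendants H c) ∪ {v}) ∪ back H v) ∪ (descendants H v ∪ back H v)ᶜ) := by
    intro x _
    by_cases hx : x ∈ descendants H v
    · by_cases hxv : x = v
      · exact Or.inl (Or.inl (Or.inr hxv))
      · obtain ⟨c, h1, h2, h3⟩ := exists_child hx hxv
        exact Or.inl (Or.inl (Or.inl (Set.mem_biUnion
          (show c ∈ T by simp [hTdef, h1, h2]) h3)))
    · by_cases hx' : x ∈ back H v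
      · exact Or.inl (Or.inr hx')
      · exact Or.inr fun h => h.elim hx hx'
  have h1 := w_mono hcover
  rw [w_univ] at h1
  have h2 := w_union (((⋃ c ∈ T, descendants H c) ∪ {v}) ∪ back H v)
    (descendants H v ∪ back H v)ᶜ
  have h3 := w_union ((⋃ c ∈ T, descendants H c) ∪ {v}) (back H v)
  have h4 := w_union (⋃ c ∈ T, descendants H c) {v}
  have h5 := w_le {v}
  rw [Set.ncard_singleton] at h5
  have h6 := (w_le (back H v)).trans (hT.ncard_back_le v)
  have h7 := hsum T le_rfl
  by_contra hcon
  have hlt : ∀ c ∈ T, v < c := fun c hc =>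
    lt_of_le_of_ne ((hTv c hc).1 ▸ parent_le c) (hTv c hc).2.symm
  -- If `k + 4 * s ≤ n`, the child subtrees weigh at least `3 * s` in total, so a group weighing
  -- less than `2 * s` leaves at least `s` for the rest. The edge forced between the two sides would
  -- join subtrees of different children.
  obtain ⟨T', hT'T, hT's, hT'2⟩ := exists_subset_sum_between (fun c => w (descendants H c)) s T hs
    (fun c hc => hvmax c (hlt c hc)) (by omega)
  have h8 := Finset.sum_sdiff (f := fun c => w (descendants H c)) hT'T
  rw [← hsum T' hT'T] at hT's hT'2 h8
  rw [← hsum (T \ T') Finset.sdiff_subset] at h8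
  obtain ⟨a, ha, b, hb, hab⟩ := gap (⋃ c ∈ T', descendants H c) (⋃ c ∈ T \ T', descendants H c)
    (by
      rw [Set.disjoint_left]
      intro x hx hx'
      simp only [Set.mem_iUnion] at hx hx'
      obtain ⟨c, hc, hxc⟩ := hx
      obtain ⟨d, hd, hxd⟩ := hx'
      obtain ⟨h1, h2⟩ := hTv c (hT'T hc)
      obtain ⟨h3, h4⟩ := hTv d (Finset.sdiff_subset hd)
      exact (Finset.mem_sdiff.1 hd).2 (eq_of_siblings h1 h2 h3 h4 hxc hxd ▸ hc)) hT's (by omega)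
  simp only [Set.mem_iUnion] at ha hb
  obtain ⟨c, hc, hac⟩ := ha
  obtain ⟨d, hd, hbd⟩ := hb
  obtain ⟨h11, h12⟩ := hTv c (hT'T hc)
  obtain ⟨h13, h14⟩ := hTv d (Finset.sdiff_subset hd)
  have hcd : c = d := by
    rcases lt_or_gt_of_ne hab.ne with h | h
    · exact eq_of_siblings h11 h12 h13 h14
        (descendants_subset hac (mem_descendants_of_adj hcl h hab)) hbd
    · exact eq_of_siblings h11 h12 h13 h14 hac
        (descendants_subset hbd (mem_descendants_of_adj hcl h hab.symm))
  exact (Finset.mem_sdiff.1 hd).2 (hcd ▸ hc)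

/-! ### Bounds for the width parameters -/

theorem width_set_nonempty {P : ℕ → ∀ m : ℕ, SimpleGraph (Fin m) → Prop}
    (hP : ∀ k, 1 ≤ k → P k (k + 1) ⊤) {n : ℕ} (hn : 2 ≤ n) (G : SimpleGraph (Fin n)) :
    n - 1 ∈ {k | 1 ≤ k ∧ ∃ (m : ℕ) (H : SimpleGraph (Fin m)), P k m H ∧ G.IsContained H} := by
  obtain ⟨k, rfl⟩ : ∃ k, n = k + 1 := ⟨n - 1, by omega⟩
  exact ⟨by omega, k + 1, ⊤, hP k (by omega), SimpleGraph.IsContained.of_le le_top⟩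

theorem width_le {P : ℕ → ∀ m : ℕ, SimpleGraph (Fin m) → Prop}
    (hP : ∀ k, 1 ≤ k → P k (k + 1) ⊤) {n : ℕ} (G : SimpleGraph (Fin n)) : width P n G ≤ n := by
  unfold width
  split_ifs with h
  · exact Nat.zero_le _
  · have hn : 2 ≤ n := by
      by_contra hn
      have : Subsingleton (Fin n) := Fin.subsingleton_iff_le_one.2 (by omega)
      exact h (Subsingleton.elim _ _)
    exact (Nat.sInf_le (width_set_nonempty hP hn G)).trans (Nat.sub_le _ _)

theorem le_width_of_hasNoGap {P : ℕ → ∀ m : ℕ, SimpleGraph (Fin m) → Prop}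
    (hP : ∀ k, 1 ≤ k → P k (k + 1) ⊤) (hPT : ∀ k m H, P k m H → IsKTree k H) {n s : ℕ}
    {G : SimpleGraph (Fin n)} (hs : 0 < s) (hsn : 2 * s ≤ n) (hG : HasNoGap G s) :
    n ≤ width P n G + 4 * s := by
  unfold width
  -- The value `0` of an edgeless graph is a convention, so this case is excluded first: there is no
  -- edge between `s` vertices and the remaining `n - s ≥ s`.
  have hne : G ≠ ⊥ := by
    rintro rfl
    obtain ⟨A, -, hA⟩ := Set.exists_subset_card_eq (s := (Set.univ : Set (Fin n))) (n := s)
      (by rw [Set.ncard_univ, Nat.card_fin]; omega)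
    have hAc := Set.ncard_add_ncard_compl A
    rw [Nat.card_fin] at hAc
    obtain ⟨a, -, b, -, hab⟩ := hG A Aᶜ disjoint_compl_right hA.ge (by omega)
    exact hab
  rw [if_neg hne]
  obtain ⟨h1, m, H, hH, hGH⟩ := Nat.sInf_mem ⟨_, width_set_nonempty hP (by omega) G⟩
  exact ((hPT _ _ _ hH).lt_of_isContained h1 hGH hs (by omega) hG).le

theorem isKTree_top (k : ℕ) : IsKTree k (⊤ : SimpleGraph (Fin (k + 1))) where
  size := le_rfl
  start _ _ h _ := h.ne
  clique v h := absurd v.isLt (by omega)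
  card v h := absurd v.isLt (by omega)

theorem treeWidth_bounds : ∀ {n s : ℕ} (G : SimpleGraph (Fin n)), treeWidth n G ≤ n ∧
    (0 < s → 2 * s ≤ n → HasNoGap G s → n ≤ treeWidth n G + 4 * s) := fun G =>
  have hP := fun k (_ : 1 ≤ k) => isKTree_top k
  ⟨width_le hP G, le_width_of_hasNoGap hP fun _ _ _ h => h⟩

theorem largeurArborescence_bounds : ∀ {n s : ℕ} (G : SimpleGraph (Fin n)),
    largeurArborescence n G ≤ n ∧
    (0 < s → 2 * s ≤ n → HasNoGap G s → n ≤ largeurArborescence n G + 4 * s) := fun G =>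
  have hP := fun k (_ : 1 ≤ k) => IsTwoSidedKTree.mk (isKTree_top k)
    fun v h => absurd v.isLt (by omega)
  ⟨width_le hP G, le_width_of_hasNoGap hP fun _ _ _ h => h.toIsKTree⟩

theorem pathWidth_bounds : ∀ {n s : ℕ} (G : SimpleGraph (Fin n)), pathWidth n G ≤ n ∧
    (0 < s → 2 * s ≤ n → HasNoGap G s → n ≤ pathWidth n G + 4 * s) := fun G =>
  have hP := fun k (_ : 1 ≤ k) => IsKCaterpillar.mk (isKTree_top k)
    fun _ v h => absurd v.isLt (by omega)
  ⟨width_le hP G, le_width_of_hasNoGap hP fun _ _ _ h => h.toIsKTree⟩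

theorem properPathWidth_bounds : ∀ {n s : ℕ} (G : SimpleGraph (Fin n)), properPathWidth n G ≤ n ∧
    (0 < s → 2 * s ≤ n → HasNoGap G s → n ≤ properPathWidth n G + 4 * s) := fun G =>
  have hP := fun k (_ : 1 ≤ k) => IsLinearKTree.mk (isKTree_top k)
    fun _ v h => absurd v.isLt (by omega)
  ⟨width_le hP G, le_width_of_hasNoGap hP fun _ _ _ h => h.toIsKTree⟩

/-! ### Decompositions from edge colourings -/

/-- The graph formed by the edges of a given colour. -/
def colorClass {r n : ℕ} (c : Sym2 (Fin n) → Fin r) (i : Fin r) : SimpleGraph (Fin n) where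
  Adj x y := x ≠ y ∧ c s(x, y) = i
  symm := ⟨fun x y h => ⟨h.1.symm, by rw [Sym2.eq_swap]; exact h.2⟩⟩
  loopless := ⟨fun x h => h.1 rfl⟩

theorem isDecomposition_colorClass {r n : ℕ} (c : Sym2 (Fin n) → Fin r) :
    IsDecomposition (colorClass c) where
  disjoint i j hij := by
    refine Set.disjoint_left.2 fun e => ?_
    induction e with
    | _ x y =>
      intro h1 h2
      exact hij ((show c s(x, y) = i from h1.2).symm.trans h2.2)
  union := by
    ext e
    induction e with
    | _ x y =>
      simp only [Set.mem_iUnion, SimpleGraph.mem_edgeSet, SimpleGraph.top_adj]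
      exact ⟨fun ⟨_, h⟩ => h.1, fun h => ⟨_, h, rfl⟩⟩

theorem finite_decomposition_sums (β : GraphParameter) (r n : ℕ) :
    {s | ∃ G : Fin r → SimpleGraph (Fin n), IsDecomposition G ∧ s = ∑ i, β n (G i)}.Finite := by
  refine (Set.finite_range fun G : Fin r → SimpleGraph (Fin n) => ∑ i, β n (G i)).subset ?_
  rintro s ⟨G, -, rfl⟩
  exact ⟨G, rfl⟩

theorem le_sumUpper (β : GraphParameter) {r n : ℕ} {G : Fin r → SimpleGraph (Fin n)}
    (hG : IsDecomposition G) : ∑ i, β n (G i) ≤ sumUpper β r n :=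
  le_csSup (finite_decomposition_sums β r n).bddAbove ⟨G, hG, rfl⟩

theorem exists_decomposition_eq_sumUpper (β : GraphParameter) {r : ℕ} (hr : 0 < r) (n : ℕ) :
    ∃ G : Fin r → SimpleGraph (Fin n), IsDecomposition G ∧ sumUpper β r n = ∑ i, β n (G i) :=
  Nat.sSup_mem (s := {s | ∃ G : Fin r → SimpleGraph (Fin n), IsDecomposition G ∧
    s = ∑ i, β n (G i)}) ⟨_, _, isDecomposition_colorClass fun _ => ⟨0, hr⟩, rfl⟩
    (finite_decomposition_sums β r n).bddAbove

/-! ### A colouring in which no colour class has large gaps -/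

theorem card_colorings_avoiding {α : Type*} [Fintype α] [DecidableEq α] {r : ℕ} (E : Finset α)
    (i : Fin r) : (Finset.univ.filter fun c : α → Fin r => ∀ e ∈ E, c e ≠ i).card =
      (r - 1) ^ E.card * r ^ (Fintype.card α - E.card) := by
  have : (Finset.univ.filter fun c : α → Fin r => ∀ e ∈ E, c e ≠ i) =
      Fintype.piFinset fun e => if e ∈ E then {i}ᶜ else Finset.univ := by
    ext c
    simp only [Finset.mem_filter, Finset.mem_univ, true_and, Fintype.mem_piFinset]
    refine forall_congr' fun e => ?_
    split_ifs with h <;> simp [h]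
  rw [this, Fintype.card_piFinset, ← Finset.prod_mul_prod_compl E]
  congr 1
  · rw [Finset.prod_congr rfl fun e he => by rw [if_pos he]]
    simp [Finset.card_compl]
  · rw [Finset.prod_congr rfl fun e he => by rw [if_neg (Finset.mem_compl.1 he)]]
    simp [Finset.card_compl]

theorem card_sym2_image {n : ℕ} {A B : Finset (Fin n)} (h : Disjoint A B) :
    ((A ×ˢ B).image fun p => s(p.1, p.2)).card = A.card * B.card := by
  rw [Finset.card_image_of_injOn, Finset.card_product]
  rintro ⟨a, b⟩ hp ⟨a', b'⟩ hp' heq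
  simp only [Finset.coe_product, Set.mem_prod, Finset.mem_coe] at hp hp'
  rcases Sym2.eq_iff.1 heq with ⟨h1, h2⟩ | ⟨h1, h2⟩
  · exact Prod.ext h1 h2
  · exact absurd (show a = b' from h1) fun h3 => Finset.disjoint_left.1 h hp.1 (h3 ▸ hp'.2)

/-- Union bound: a given colour is absent between two given disjoint `s`-sets in a fraction `((r -
1) / r) ^ (s * s)` of all colourings, and there are at most `r * 4 ^ n` choices of a colour and two
sets. -/
theorem exists_coloring_hasNoGap {r n s : ℕ} (hr : 0 < r)
    (h : r * 4 ^ n * (r - 1) ^ (s * s) < r ^ (s * s)) :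
    ∃ c : Sym2 (Fin n) → Fin r, ∀ i, HasNoGap (colorClass c i) s := by
  classical
  suffices hc : ∃ c : Sym2 (Fin n) → Fin r, ∀ (i : Fin r) (A B : Finset (Fin n)), Disjoint A B →
      A.card = s → B.card = s → ∃ a ∈ A, ∃ b ∈ B, c s(a, b) = i by
    obtain ⟨c, hc⟩ := hc
    refine ⟨c, fun i A B hAB hA hB => ?_⟩
    obtain ⟨A', hA', hA's⟩ := Set.exists_subset_card_eq hA
    obtain ⟨B', hB', hB's⟩ := Set.exists_subset_card_eq hB
    obtain ⟨a, ha, b, hb, hab⟩ := hc i A'.toFinset B'.toFinset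
      (by rw [Set.disjoint_toFinset]; exact hAB.mono hA' hB')
      (by rw [← hA's, Set.ncard_eq_toFinset_card']) (by rw [← hB's, Set.ncard_eq_toFinset_card'])
    rw [Set.mem_toFinset] at ha hb
    exact ⟨a, hA' ha, b, hB' hb, fun h => Set.disjoint_left.1 hAB (hA' ha) (h ▸ hB' hb), hab⟩
  by_contra! hcon
  set I : Finset (Fin r × Finset (Fin n) × Finset (Fin n)) := Finset.univ.filter fun t =>
    Disjoint t.2.1 t.2.2 ∧ t.2.1.card = s ∧ t.2.2.card = s with hI
  set N := Fintype.card (Sym2 (Fin n))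
  have hcover : (Finset.univ : Finset (Sym2 (Fin n) → Fin r)) ⊆ I.biUnion fun t =>
      Finset.univ.filter fun c => ∀ e ∈ (t.2.1 ×ˢ t.2.2).image fun p => s(p.1, p.2), c e ≠ t.1 := by
    intro c _
    obtain ⟨i, A, B, hAB, hA, hB, hne⟩ := hcon c
    refine Finset.mem_biUnion.2 ⟨(i, A, B), by simp [hI, hAB, hA, hB], ?_⟩
    simp only [Finset.mem_filter, Finset.mem_univ, true_and, Finset.mem_image, Finset.mem_product]
    rintro e ⟨⟨a, b⟩, ⟨ha, hb⟩, rfl⟩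
    exact hne a ha b hb
  have h1 := (Finset.card_le_card hcover).trans (Finset.card_biUnion_le_card_mul _ _
    ((r - 1) ^ (s * s) * r ^ (N - s * s)) fun t ht => by
      obtain ⟨h1, h2, h3⟩ := (Finset.mem_filter.1 ht).2
      rw [card_colorings_avoiding, card_sym2_image h1, h2, h3])
  have hIcard : I.card ≤ r * 4 ^ n := by
    refine (Finset.card_le_univ _).trans (le_of_eq ?_)
    simp [Fintype.card_prod, ← mul_pow]
  rw [Finset.card_univ, Fintype.card_fun, Fintype.card_fin] at h1
  by_cases hN : s * s ≤ N
  · have h2 : r ^ N = r ^ (s * s) * r ^ (N - s * s) := by rw [← pow_add]; congr 1; omega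
    have h3 := h1.trans (Nat.mul_le_mul_right _ hIcard)
    rw [h2, ← mul_assoc] at h3
    have h4 := Nat.le_of_mul_le_mul_right h3 (pow_pos hr _)
    omega
  -- Here `n` is too small for two disjoint `s`-sets to exist, so no colouring can be bad.
  · have hI0 : I = ∅ := by
      refine Finset.eq_empty_of_forall_notMem fun t ht => hN ?_
      obtain ⟨h1, h2, h3⟩ := (Finset.mem_filter.1 ht).2
      have := card_sym2_image h1
      rw [h2, h3] at this
      exact this ▸ Finset.card_le_univ _
    rw [hI0] at h1
    have := pow_pos hr N
    simp at h1
    omega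

theorem exists_decomposition_hasNoGap {r : ℕ} (hr : 2 ≤ r) :
    ∃ K : ℕ, ∀ n, r ≤ n → ∀ s, K * n ≤ s * s →
      ∃ G : Fin r → SimpleGraph (Fin n), IsDecomposition G ∧ ∀ i, HasNoGap (G i) s := by
  -- The exponent `K * n` then gains a factor `8 ^ n`, of which `4 ^ n` pays for the pairs of sets
  -- and `2 ^ n > r` for the colours.
  obtain ⟨K, hK⟩ : ∃ K : ℕ, (r - 1) ^ K * 8 ≤ r ^ K := by
    have hr0 : (0 : ℝ) < r := by positivity
    obtain ⟨K, hK⟩ := exists_pow_lt_of_lt_one (show (0 : ℝ) < 1 / 8 by norm_num)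
      (show ((r - 1 : ℕ) : ℝ) / r < 1 by
        rw [div_lt_one hr0]; exact_mod_cast Nat.sub_lt (by omega) one_pos)
    refine ⟨K, ?_⟩
    rw [div_pow, div_lt_div_iff₀ (by positivity) (by norm_num)] at hK
    have : ((r - 1 : ℕ) : ℝ) ^ K * 8 ≤ (r : ℝ) ^ K := by linarith
    exact_mod_cast this
  refine ⟨K, fun n hn s hs => ?_⟩
  obtain ⟨c, hc⟩ := exists_coloring_hasNoGap (r := r) (n := n) (s := s) (by omega) (by
    obtain ⟨t, ht⟩ := Nat.exists_eq_add_of_le hs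
    rw [ht, pow_add, pow_add, pow_mul, pow_mul]
    have h1 : ((r - 1) ^ K) ^ n * 8 ^ n ≤ (r ^ K) ^ n := by
      rw [← mul_pow]; exact Nat.pow_le_pow_left hK n
    have h2 : (r - 1) ^ t ≤ r ^ t := Nat.pow_le_pow_left (Nat.sub_le _ _) t
    have h3 : r < 2 ^ n := hn.trans_lt Nat.lt_two_pow_self
    have h4 : 0 < ((r - 1) ^ K) ^ n := pow_pos (pow_pos (by omega) _) _
    have h5 : 0 < r ^ t := pow_pos (by omega) _
    have h6 : (8 : ℕ) ^ n = 2 ^ n * 4 ^ n := by rw [← mul_pow]; norm_num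
    calc r * 4 ^ n * (((r - 1) ^ K) ^ n * (r - 1) ^ t)
        ≤ r * (4 ^ n * ((r - 1) ^ K) ^ n * r ^ t) := by
          rw [mul_assoc, ← mul_assoc (4 ^ n)]; gcongr
      _ < 2 ^ n * (4 ^ n * ((r - 1) ^ K) ^ n * r ^ t) :=
          Nat.mul_lt_mul_of_pos_right h3 (by positivity)
      _ = ((r - 1) ^ K) ^ n * 8 ^ n * r ^ t := by rw [h6]; ring
      _ ≤ (r ^ K) ^ n * r ^ t := Nat.mul_le_mul_right _ h1)
  exact ⟨_, isDecomposition_colorClass c, hc⟩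

/-- A parameter that is at most the number of vertices, and close to it on graphs without large
gaps, has the largest possible sum upper bound asymptotically. -/
theorem tendsto_sumUpper_of_hasNoGap {r : ℕ} (hr : 2 ≤ r) {β : GraphParameter}
    (hβ : ∀ {n s : ℕ} (G : SimpleGraph (Fin n)), β n G ≤ n ∧
      (0 < s → 2 * s ≤ n → HasNoGap G s → n ≤ β n G + 4 * s)) :
    Tendsto (fun n : ℕ => (sumUpper β r n : ℝ) / (n : ℝ)) atTop (𝓝 (r : ℝ)) := by
  obtain ⟨K, hK⟩ := exists_decomposition_hasNoGap hr
  have hlim : Tendsto (fun n : ℕ => (r : ℝ) - 4 * r * (√K / √n + 1 / n)) atTop (𝓝 r) := by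
    have h1 : Tendsto (fun n : ℕ => √K / √(n : ℝ)) atTop (𝓝 0) :=
      Tendsto.const_div_atTop (Real.tendsto_sqrt_atTop.comp tendsto_natCast_atTop_atTop) _
    have h2 := (h1.add tendsto_one_div_atTop_nhds_zero_nat).const_mul (4 * r : ℝ)
    simpa using h2.const_sub (r : ℝ)
  refine tendsto_of_tendsto_of_tendsto_of_le_of_le' hlim tendsto_const_nhds ?_ ?_
  -- The bound `16 * K` gives `4 * Nat.sqrt (K * n) ≤ n`, and the `8` absorbs the added `1` in `s`,
  -- so that `2 * s ≤ n`.
  · filter_upwards [eventually_ge_atTop (max r (16 * K + 8))] with n hn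
    have hn0 : (0 : ℝ) < n := by
      have : 0 < n := by have := le_of_max_le_left hn; omega
      exact_mod_cast this
    set s := Nat.sqrt (K * n) + 1 with hs
    have hs1 : K * n ≤ s * s := (Nat.lt_succ_sqrt _).le
    have hsn : (s : ℝ) ≤ √K * √n + 1 := by
      rw [hs]; push_cast
      rw [← Real.sqrt_mul (Nat.cast_nonneg _)]
      gcongr
      exact_mod_cast Real.nat_sqrt_le_real_sqrt (a := K * n)
    have hs2 : 2 * s ≤ n := by
      have hn2 := le_of_max_le_right hn
      have : Nat.sqrt (K * n) * 4 ≤ n := by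
        have h1 := Nat.sqrt_le (K * n)
        by_contra h
        have h2 : 16 * K * n ≤ n * n := Nat.mul_le_mul_right n (by omega)
        nlinarith
      omega
    obtain ⟨G, hG, hgap⟩ := hK n (le_of_max_le_left hn) s hs1
    have h1 := le_sumUpper β hG
    have h2 : (r : ℝ) * (n - 4 * s) ≤ sumUpper β r n := by
      calc (r : ℝ) * (n - 4 * s) = ∑ _i : Fin r, ((n : ℝ) - 4 * s) := by
              rw [Finset.sum_const, Finset.card_univ, Fintype.card_fin, nsmul_eq_mul]
        _ ≤ ∑ i : Fin r, (β n (G i) : ℝ) := Finset.sum_le_sum fun i _ => by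
            have := (hβ (G i)).2 (Nat.succ_pos _) hs2 (hgap i)
            have : (n : ℝ) ≤ β n (G i) + 4 * s := by exact_mod_cast this
            linarith
        _ ≤ _ := by exact_mod_cast h1
    rw [le_div_iff₀ hn0]
    have h3 : √K / √(n : ℝ) * n = √K * √n := by
      have := Real.sqrt_pos.2 hn0
      field_simp
      rw [Real.sq_sqrt hn0.le]
    have h4 : ((r : ℝ) - 4 * r * (√K / √n + 1 / n)) * n = r * (n - 4 * (√K * √n + 1)) := by
      have : 1 / (n : ℝ) * n = 1 := by field_simp
      linear_combination (-4 * (r : ℝ)) * h3 - 4 * r * this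
    rw [h4]
    refine le_trans ?_ h2
    gcongr
  · filter_upwards [eventually_gt_atTop 0] with n hn
    have hn0 : (0 : ℝ) < n := by exact_mod_cast hn
    rw [div_le_iff₀ hn0]
    obtain ⟨G, -, h⟩ := exists_decomposition_eq_sumUpper β (show 0 < r by omega) n
    have : ∑ i, β n (G i) ≤ ∑ _i : Fin r, n := Finset.sum_le_sum fun i _ => (hβ (s := 0) (G i)).1
    rw [h]
    simp only [Finset.sum_const, Finset.card_univ, Fintype.card_fin, smul_eq_mul] at this
    exact_mod_cast this

/-! ### Upper bounds from the number of edges -/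

open Classical in
/-- The number of ordered pairs of adjacent vertices, which is twice the number of edges. -/
noncomputable def adjPairs {n : ℕ} (G : SimpleGraph (Fin n)) : ℕ :=
  (Finset.univ.filter fun p : Fin n × Fin n => G.Adj p.1 p.2).card

theorem sum_adjPairs_le {r n : ℕ} {G : Fin r → SimpleGraph (Fin n)} (hG : IsDecomposition G) :
    ∑ i, adjPairs (G i) ≤ n ^ 2 := by
  classical
  unfold adjPairs
  rw [← Finset.card_biUnion]
  · refine (Finset.card_le_univ _).trans (le_of_eq ?_)
    simp [sq]
  · intro i _ j _ hij
    rw [Function.onFun, Finset.disjoint_left]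
    intro p hp hp'
    have hdis : Disjoint (G i).edgeSet (G j).edgeSet := hG.disjoint hij
    have hi : s(p.1, p.2) ∈ (G i).edgeSet := (Finset.mem_filter.1 hp).2
    exact Set.disjoint_left.1 hdis hi (Finset.mem_filter.1 hp').2

/-! ### Clique minors versus edges -/

theorem IsMinor.le_card {n k : ℕ} {G : SimpleGraph (Fin n)}
    (h : IsMinor (⊤ : SimpleGraph (Fin k)) G) : k ≤ n := by
  obtain ⟨B, h1, h2, -⟩ := h
  choose f hf using fun w => (Set.nonempty_coe_sort.1 (h1 w).nonempty)
  have hinj : Function.Injective f := fun a b hab => by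
    by_contra hne
    exact Set.disjoint_left.1 (h2 hne) (hf a) (hab ▸ hf b)
  simpa using Fintype.card_le_of_injective f hinj

/-- Each ordered pair of distinct branch sets picks an edge between them. Disjointness of the branch
sets recovers the pair from the ends of the edge. -/
theorem IsMinor.mul_le_adjPairs {n k : ℕ} {G : SimpleGraph (Fin n)}
    (h : IsMinor (⊤ : SimpleGraph (Fin k)) G) : k * (k - 1) ≤ adjPairs G := by
  classical
  obtain ⟨B, h1, h2, h3⟩ := h
  have h4 : ∀ a b, ∃ x ∈ B a, ∃ y ∈ B b, a ≠ b → G.Adj x y := fun a b => by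
    by_cases hab : a = b
    · obtain ⟨x, hx⟩ := Set.nonempty_coe_sort.1 (h1 a).nonempty
      exact ⟨x, hx, x, hab ▸ hx, fun h => absurd hab h⟩
    · obtain ⟨x, hx, y, hy, hxy⟩ := h3 a b hab
      exact ⟨x, hx, y, hy, fun _ => hxy⟩
  choose f hf g hg hfg using h4
  have hB : ∀ {a b x}, x ∈ B a → x ∈ B b → a = b := fun ha hb => by
    by_contra hne
    exact Set.disjoint_left.1 (h2 hne) ha hb
  have hcard : (Finset.univ : Finset (Fin k)).offDiag.card = k * (k - 1) := by
    rw [Finset.offDiag_card, Finset.card_univ, Fintype.card_fin, Nat.mul_sub_one]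
  rw [← hcard, adjPairs]
  refine Finset.card_le_card_of_injOn (fun p => (f p.1 p.2, g p.1 p.2)) ?_ ?_
  · intro p hp
    have : p.1 ≠ p.2 := (Finset.mem_offDiag.1 hp).2.2
    simpa using hfg p.1 p.2 this
  · intro p _ q _ hpq
    rw [Prod.mk.injEq] at hpq
    exact Prod.ext (hB (hf p.1 p.2) (hpq.1.symm ▸ hf q.1 q.2)) (hB (hg p.1 p.2) (hpq.2.symm ▸ hg q.1 q.2))

theorem bddAbove_isMinor {n : ℕ} (G : SimpleGraph (Fin n)) :
    BddAbove {k | IsMinor (⊤ : SimpleGraph (Fin k)) G} := ⟨n, fun _ h => h.le_card⟩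

theorem hadwiger_mul_le {n : ℕ} (G : SimpleGraph (Fin n)) :
    hadwiger n G * (hadwiger n G - 1) ≤ 2 * n + adjPairs G := by
  have hmem : hadwiger n G ∈ {k | IsMinor (⊤ : SimpleGraph (Fin k)) G} :=
    Nat.sSup_mem ⟨0, fun _ => ∅, fun w => w.elim0, fun w => w.elim0, fun w => w.elim0⟩
      (bddAbove_isMinor G)
  exact (IsMinor.mul_le_adjPairs hmem).trans (Nat.le_add_left _ _)

/-! ### Nullity versus edges under the Strong Arnold Property -/

theorem nullity_le {n : ℕ} (A : Matrix (Fin n) (Fin n) ℝ) : nullity A ≤ n :=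
  (Submodule.finrank_le _).trans (by simp)

theorem two_mul_card_le {n : ℕ} (G : SimpleGraph (Fin n)) {S : Finset (Fin n × Fin n)}
    (hS : ∀ p ∈ S, p.1 = p.2 ∨ (G.Adj p.1 p.2 ∧ p.1 < p.2)) :
    2 * S.card ≤ 2 * n + adjPairs G := by
  classical
  have h1 : (Finset.univ.filter fun p : Fin n × Fin n => p.1 = p.2).card ≤ n := by
    have : (Finset.univ.filter fun p : Fin n × Fin n => p.1 = p.2) ⊆
        Finset.univ.image fun x => (x, x) := by
      rintro ⟨x, y⟩ h
      obtain rfl : x = y := (Finset.mem_filter.1 h).2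
      exact Finset.mem_image_of_mem _ (Finset.mem_univ x)
    simpa using (Finset.card_le_card this).trans Finset.card_image_le
  set L := Finset.univ.filter fun p : Fin n × Fin n => G.Adj p.1 p.2 ∧ p.1 < p.2 with hL
  have h2 : (L ∪ L.image Prod.swap).card = L.card + L.card := by
    rw [Finset.card_union_of_disjoint, Finset.card_image_of_injective _ Prod.swap_injective]
    rw [Finset.disjoint_left]
    rintro p hp hp'
    obtain ⟨q, hq, rfl⟩ := Finset.mem_image.1 hp'
    exact lt_asymm (Finset.mem_filter.1 hp).2.2 (Finset.mem_filter.1 hq).2.2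
  have h3 : (L ∪ L.image Prod.swap).card ≤ adjPairs G := by
    refine Finset.card_le_card fun p hp => ?_
    rw [Finset.mem_filter]
    refine ⟨Finset.mem_univ _, ?_⟩
    rcases Finset.mem_union.1 hp with h | h
    · exact (Finset.mem_filter.1 h).2.1
    · obtain ⟨q, hq, rfl⟩ := Finset.mem_image.1 h
      exact (Finset.mem_filter.1 hq).2.1.symm
  have h4 := Finset.card_union_le (Finset.univ.filter fun p : Fin n × Fin n => p.1 = p.2) L
  have h5 : S ⊆ (Finset.univ.filter fun p : Fin n × Fin n => p.1 = p.2) ∪ L := fun p hp => by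
    simpa [hL] using hS p hp
  have h6 := Finset.card_le_card h5
  omega

/-- Let the columns of `V` be a basis of the kernel. For symmetric `Y`, the matrix `X = V * Y * Vᵀ`
is symmetric with `A * X = 0`; if it vanishes on the diagonal and on the edges, the Strong Arnold
Property forces `X = 0`, hence `Y = 0`. So the space of symmetric `k × k` matrices has dimension at
most `n` plus the number of edges. -/
theorem nullity_mul_le {n : ℕ} {G : SimpleGraph (Fin n)} {A : Matrix (Fin n) (Fin n) ℝ}
    (hA : IsDescribedBy A G) (hS : StrongArnold A) :
    nullity A * (nullity A - 1) ≤ 2 * n + adjPairs G := by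
  classical
  set k := nullity A with hk
  obtain ⟨b⟩ : Nonempty (Module.Basis (Fin k) ℝ (LinearMap.ker A.mulVecLin)) :=
    ⟨Module.finBasis ℝ _⟩
  have hb : LinearIndependent ℝ fun a => (b a : Fin n → ℝ) :=
    b.linearIndependent.map' (LinearMap.ker A.mulVecLin).subtype (Submodule.ker_subtype _)
  set V : Matrix (Fin n) (Fin k) ℝ := Matrix.of fun x a => (b a : Fin n → ℝ) x with hV
  have hVinj : Function.Injective V.mulVec := by
    rw [Matrix.mulVec_injective_iff]
    exact hb
  have hAV : A * V = 0 := by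
    ext x a
    exact congrFun (LinearMap.mem_ker.1 (b a).2) x
  have hcancel : ∀ {m : ℕ} (M : Matrix (Fin k) (Fin m) ℝ), V * M = 0 → M = 0 := by
    intro m M hM
    ext a j
    have : V.mulVec (fun i => M i j) = V.mulVec 0 := by
      rw [Matrix.mulVec_zero]
      ext x
      exact congrFun (congrFun hM x) j
    exact congrFun (hVinj this) a
  set S := Finset.univ.filter fun p : Fin n × Fin n => p.1 = p.2 ∨ (G.Adj p.1 p.2 ∧ p.1 < p.2)
  let Y : (Sym2 (Fin k) → ℝ) →ₗ[ℝ] Matrix (Fin k) (Fin k) ℝ :=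
    { toFun := fun f => Matrix.of fun a b => f s(a, b)
      map_add' := fun _ _ => rfl
      map_smul' := fun _ _ => rfl }
  let Φ : (Sym2 (Fin k) → ℝ) →ₗ[ℝ] (S → ℝ) :=
    { toFun := fun f p => (V * Y f * Vᵀ) p.1.1 p.1.2
      map_add' := fun f g => by
        ext p; simp [Matrix.mul_add, Matrix.add_mul]
      map_smul' := fun c f => by
        ext p; simp }
  have hΦ : Function.Injective Φ := by
    rw [← LinearMap.ker_eq_bot, LinearMap.ker_eq_bot']
    intro f hf
    have hYs : (Y f)ᵀ = Y f := by
      ext a b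
      exact congrArg f Sym2.eq_swap
    set X := V * Y f * Vᵀ with hX
    have hXs : X.IsSymm := by
      rw [Matrix.IsSymm, hX]
      simp [Matrix.transpose_mul, hYs, Matrix.mul_assoc]
    have hXS : ∀ x y, x = y ∨ (G.Adj x y ∧ x < y) → X x y = 0 := fun x y h =>
      congrFun hf ⟨(x, y), by simpa [S] using h⟩
    have hXG : ∀ x y, G.Adj x y → X x y = 0 := fun x y h => by
      rcases lt_or_gt_of_ne h.ne with h1 | h1
      · exact hXS x y (Or.inr ⟨h, h1⟩)
      · rw [← hXs.apply]; exact hXS y x (Or.inr ⟨h.symm, h1⟩)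
    have hX0 : X = 0 := by
      by_contra hne
      refine hS ⟨X, hne, hXs, ?_, ?_, ?_⟩
      · rw [hX, ← Matrix.mul_assoc, ← Matrix.mul_assoc, hAV]; simp
      · ext x y
        rw [Matrix.hadamard_apply, Matrix.zero_apply]
        by_cases hxy : x = y
        · rw [hXS x y (Or.inl hxy), mul_zero]
        · by_cases h : G.Adj x y
          · rw [hXG x y h, mul_zero]
          · rw [not_not.1 (mt (hA.graph x y hxy).1 h), zero_mul]
      · ext x y
        rw [Matrix.hadamard_apply, Matrix.zero_apply]
        by_cases hxy : x = y
        · rw [hXS x y (Or.inl hxy), mul_zero]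
        · rw [Matrix.one_apply_ne hxy, zero_mul]
    rw [hX, Matrix.mul_assoc] at hX0
    have h1 := congrArg Matrix.transpose (hcancel _ hX0)
    rw [Matrix.transpose_mul, Matrix.transpose_transpose, hYs, Matrix.transpose_zero] at h1
    have h2 := hcancel _ h1
    ext e
    induction e with
    | _ a b => exact congrFun (congrFun h2 a) b
  have h1 := LinearMap.finrank_le_finrank_of_injective hΦ
  rw [Module.finrank_fintype_fun_eq_card, Module.finrank_fintype_fun_eq_card, Sym2.card,
    Fintype.card_fin, Fintype.card_coe, Nat.choose_two_right] at h1
  have h2 := two_mul_card_le G (S := S) fun p hp => (Finset.mem_filter.1 hp).2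
  have h3 := Nat.even_mul_pred_self (k + 1)
  have h4 : (k + 1) * (k + 1 - 1) ≤ 2 * n + adjPairs G := by
    have := Nat.div_mul_cancel h3.two_dvd
    omega
  -- The argument gives `(k + 1) * k`; the weaker `k * (k - 1)` is the form shared with the Hadwiger
  -- number.
  exact le_trans (by rw [Nat.add_sub_cancel, mul_comm]; exact Nat.mul_le_mul_right _ (by omega)) h4

theorem sSup_nullity_mul_le {n : ℕ} (G : SimpleGraph (Fin n)) {S : Set ℕ}
    (hS : ∀ k ∈ S, ∃ A, IsDescribedBy A G ∧ StrongArnold A ∧ nullity A = k) :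
    sSup S * (sSup S - 1) ≤ 2 * n + adjPairs G := by
  rcases S.eq_empty_or_nonempty with rfl | hne
  · simp
  · obtain ⟨A, h1, h2, h3⟩ := hS _ (Nat.sSup_mem hne ⟨n, fun k hk => by
      obtain ⟨A, -, -, rfl⟩ := hS k hk
      exact nullity_le A⟩)
    rw [← h3]
    exact nullity_mul_le h1 h2

theorem xi_mul_le {n : ℕ} (G : SimpleGraph (Fin n)) :
    xi n G * (xi n G - 1) ≤ 2 * n + adjPairs G :=
  sSup_nullity_mul_le G fun _ h => h

theorem nu_mul_le {n : ℕ} (G : SimpleGraph (Fin n)) :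
    nu n G * (nu n G - 1) ≤ 2 * n + adjPairs G :=
  sSup_nullity_mul_le G fun _ ⟨A, h1, h2, _, h3⟩ => ⟨A, h1, h2, h3⟩

theorem mu_mul_le {n : ℕ} (G : SimpleGraph (Fin n)) :
    mu n G * (mu n G - 1) ≤ 2 * n + adjPairs G :=
  sSup_nullity_mul_le G fun _ ⟨A, h1, h2, _, _, h3⟩ => ⟨A, h1, h2, h3⟩

/-- From `(β - 1) ^ 2 ≤ β * (β - 1)` for `β ≥ 1`, each summand is at most `1` plus a square root.
Cauchy-Schwarz combines the roots, since the edge counts add up to at most those of the complete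
graph. -/
theorem sumUpper_le_of_mul_le {r : ℕ} (hr : 0 < r) {β : GraphParameter}
    (hβ : ∀ {n : ℕ} (G : SimpleGraph (Fin n)), β n G * (β n G - 1) ≤ 2 * n + adjPairs G) (n : ℕ) :
    (sumUpper β r n : ℝ) ≤ r + √r * √(2 * r * n + n ^ 2) := by
  obtain ⟨G, hG, h⟩ := exists_decomposition_eq_sumUpper β hr n
  have h1 : ∀ i, (β n (G i) : ℝ) ≤ 1 + √(2 * n + adjPairs (G i)) := by
    intro i
    rw [← sub_le_iff_le_add']
    rcases Nat.eq_zero_or_pos (β n (G i)) with h0 | h0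
    · rw [h0, Nat.cast_zero]
      exact le_trans (by norm_num) (Real.sqrt_nonneg _)
    · refine Real.le_sqrt_of_sq_le ?_
      have h2 : (β n (G i) : ℝ) * (β n (G i) - 1) ≤ 2 * n + adjPairs (G i) := by
        have := hβ (G i)
        rw [← Nat.cast_pred h0]
        exact_mod_cast this
      have h3 : (1 : ℝ) ≤ β n (G i) := by exact_mod_cast h0
      nlinarith
  have h2 : (∑ i, √(2 * (n : ℝ) + adjPairs (G i))) ^ 2 ≤ r * (2 * r * n + n ^ 2) := by
    refine sq_sum_le_card_mul_sum_sq.trans ?_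
    rw [Finset.card_univ, Fintype.card_fin]
    refine mul_le_mul_of_nonneg_left ?_ (Nat.cast_nonneg _)
    rw [Finset.sum_congr rfl fun i _ => Real.sq_sqrt (by positivity), Finset.sum_add_distrib,
      Finset.sum_const, Finset.card_univ, Fintype.card_fin, nsmul_eq_mul]
    have : (∑ i, (adjPairs (G i) : ℝ)) ≤ n ^ 2 := by exact_mod_cast sum_adjPairs_le hG
    linarith
  rw [h, ← Real.sqrt_mul (Nat.cast_nonneg _)]
  push_cast
  calc ∑ i, (β n (G i) : ℝ) ≤ ∑ i, (1 + √(2 * (n : ℝ) + adjPairs (G i))) :=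
        Finset.sum_le_sum fun i _ => h1 i
    _ = r + ∑ i, √(2 * (n : ℝ) + adjPairs (G i)) := by
        rw [Finset.sum_add_distrib]; simp
    _ ≤ _ := by gcongr; exact Real.le_sqrt_of_sq_le h2

theorem tendsto_sqrt_bound (r : ℕ) :
    Tendsto (fun n : ℕ => (r + √r * √(2 * r * n + (n : ℝ) ^ 2)) / n) atTop (𝓝 √r) := by
  have h1 : Tendsto (fun n : ℕ => r * (1 / (n : ℝ)) + √r * √(2 * r * (1 / (n : ℝ)) + 1)) atTop
      (𝓝 (r * 0 + √r * √(2 * r * 0 + 1))) := by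
    have h := tendsto_one_div_atTop_nhds_zero_nat (𝕜 := ℝ)
    exact (h.const_mul _).add ((((h.const_mul _).add_const _).sqrt).const_mul _)
  rw [mul_zero, mul_zero, zero_add, zero_add, Real.sqrt_one, mul_one] at h1
  refine h1.congr' ?_
  filter_upwards [eventually_gt_atTop 0] with n hn
  have hn0 : (0 : ℝ) < n := by exact_mod_cast hn
  have h2 : 2 * (r : ℝ) * n + (n : ℝ) ^ 2 = n ^ 2 * (2 * r * (1 / (n : ℝ)) + 1) := by
    field_simp
  rw [h2, Real.sqrt_mul (by positivity), Real.sqrt_sq hn0.le]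
  field_simp

/-! ### Matrices of large nullity -/

/-- The vector `z` forces a negative eigenvalue. Two of them would make the form negative definite
on a plane, which meets the hyperplane orthogonal to `w` in a nonzero vector. -/
theorem oneNegEigenvalue_of_form {n : ℕ} {A : Matrix (Fin n) (Fin n) ℝ} (hA : A.IsSymm)
    {w z : Fin n → ℝ} (hz : z ⬝ᵥ A *ᵥ z < 0) (hw : ∀ x, w ⬝ᵥ x = 0 → 0 ≤ x ⬝ᵥ A *ᵥ x) :
    OneNegEigenvalue A := by
  have hH : A.IsHermitian := by
    rw [Matrix.IsHermitian, Matrix.conjTranspose_eq_transpose_of_trivial]; exact hA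
  refine ⟨hH, ?_⟩
  obtain ⟨i, hi⟩ : ∃ i, hH.eigenvalues i < 0 := by
    by_contra! h
    have := (hH.posSemidef_iff_eigenvalues_nonneg.2 h).dotProduct_mulVec_nonneg z
    rw [star_trivial] at this
    linarith
  refine ⟨i, hi, fun j hj => ?_⟩
  by_contra hne
  set v : Fin n → Fin n → ℝ := fun l => (hH.eigenvectorBasis l).ofLp with hv
  have hAv : ∀ l, A *ᵥ v l = hH.eigenvalues l • v l := hH.mulVec_eigenvectorBasis
  have hdot : ∀ l l', v l ⬝ᵥ v l' = if l = l' then 1 else 0 := fun l l' => by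
    have := orthonormal_iff_ite.1 hH.eigenvectorBasis.orthonormal l' l
    rw [EuclideanSpace.inner_eq_star_dotProduct, star_trivial] at this
    rw [hv]
    dsimp only
    rw [this]
    simp only [eq_comm]
  have hii := hdot i i
  have hjj := hdot j j
  have hij := hdot i j
  have hji := hdot j i
  rw [if_pos rfl] at hii hjj
  rw [if_neg hne] at hji
  rw [if_neg (Ne.symm hne)] at hij
  by_cases hp : w ⬝ᵥ v i = 0
  · have := hw _ hp
    rw [hAv, dotProduct_smul, hii, smul_eq_mul] at this
    linarith
  -- This combination of the two eigenvectors is orthogonal to `w`.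
  · have := hw ((w ⬝ᵥ v j) • v i - (w ⬝ᵥ v i) • v j) (by
      rw [dotProduct_sub, dotProduct_smul, dotProduct_smul, smul_eq_mul, smul_eq_mul]; ring)
    rw [Matrix.mulVec_sub, Matrix.mulVec_smul, Matrix.mulVec_smul, hAv, hAv] at this
    simp only [dotProduct_sub, sub_dotProduct, dotProduct_smul, smul_dotProduct, hii, hij, hji,
      hjj, smul_eq_mul] at this
    have h1 : 0 < (w ⬝ᵥ v i) ^ 2 := by positivity
    nlinarith [sq_nonneg (w ⬝ᵥ v j), mul_neg_of_pos_of_neg h1 hj]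

section GramShift

variable {n : ℕ} (U : Finset (Fin n)) (C : Matrix (Fin n) (Fin n) ℝ) (τ : ℝ)

/-- The matrix with blocks `C Cᵀ + τ J`, `C`, `Cᵀ`, `1`, the first block belonging to `U`. -/
noncomputable def gramShift : Matrix (Fin n) (Fin n) ℝ :=
  (C + Matrix.diagonal fun x => if x ∈ U then 0 else 1) *
      (C + Matrix.diagonal fun x => if x ∈ U then 0 else 1)ᵀ +
    τ • Matrix.vecMulVec (fun x => if x ∈ U then 1 else 0) (fun x => if x ∈ U then 1 else 0)

variable {U C τ}

theorem gramShift_isSymm : (gramShift U C τ).IsSymm := by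
  unfold gramShift
  rw [Matrix.IsSymm, Matrix.transpose_add, Matrix.transpose_mul, Matrix.transpose_transpose,
    Matrix.transpose_smul, Matrix.transpose_vecMulVec]

theorem gramShift_apply (hC : ∀ x y, C x y ≠ 0 → x ∈ U ∧ y ∉ U) (x y : Fin n) :
    gramShift U C τ x y = (C * Cᵀ) x y + C x y + C y x +
      (if x = y ∧ x ∉ U then 1 else 0) + τ * (if x ∈ U ∧ y ∈ U then 1 else 0) := by
  have hCD : ∀ x y, C x y * (if y ∈ U then 0 else 1) = C x y := fun x y => by
    by_cases h : C x y = 0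
    · rw [h, zero_mul]
    · rw [if_neg (hC x y h).2, mul_one]
  rw [gramShift, Matrix.transpose_add, Matrix.diagonal_transpose, Matrix.add_mul, Matrix.mul_add,
    Matrix.mul_add, Matrix.diagonal_mul_diagonal]
  simp only [Matrix.add_apply, Matrix.mul_diagonal, Matrix.diagonal_mul, Matrix.transpose_apply,
    Matrix.smul_apply, Matrix.vecMulVec_apply, hCD, smul_eq_mul]
  rw [mul_comm _ (C y x), hCD, Matrix.diagonal_apply]
  by_cases hx : x ∈ U <;> by_cases hy : y ∈ U <;> by_cases hxy : x = y <;>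
    simp [hx, hy, hxy] <;> ring

theorem eq_zero_of_mem_right (hC : ∀ x y, C x y ≠ 0 → x ∈ U ∧ y ∉ U) {x y : Fin n} (hy : y ∈ U) :
    C x y = 0 := by
  by_contra h; exact (hC x y h).2 hy

theorem eq_zero_of_notMem_left (hC : ∀ x y, C x y ≠ 0 → x ∈ U ∧ y ∉ U) {x y : Fin n}
    (hx : x ∉ U) : C x y = 0 := by
  by_contra h; exact hx (hC x y h).1

theorem gramShift_apply_mem_mem (hC : ∀ x y, C x y ≠ 0 → x ∈ U ∧ y ∉ U) {x y : Fin n}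
    (hx : x ∈ U) (hy : y ∈ U) : gramShift U C τ x y = (C * Cᵀ) x y + τ := by
  rw [gramShift_apply hC, eq_zero_of_mem_right hC hy, eq_zero_of_mem_right hC hx]
  simp [hx, hy]

theorem gramShift_apply_mem_notMem (hC : ∀ x y, C x y ≠ 0 → x ∈ U ∧ y ∉ U) {x y : Fin n}
    (hx : x ∈ U) (hy : y ∉ U) : gramShift U C τ x y = C x y := by
  have h : (C * Cᵀ) x y = 0 := by
    rw [Matrix.mul_apply]
    exact Finset.sum_eq_zero fun z _ => by
      rw [Matrix.transpose_apply, eq_zero_of_notMem_left hC hy, mul_zero]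
  rw [gramShift_apply hC, h, eq_zero_of_notMem_left hC hy]
  simp [hx, hy]

theorem gramShift_apply_notMem_mem (hC : ∀ x y, C x y ≠ 0 → x ∈ U ∧ y ∉ U) {x y : Fin n}
    (hx : x ∉ U) (hy : y ∈ U) : gramShift U C τ x y = C y x := by
  rw [← gramShift_isSymm.apply, gramShift_apply_mem_notMem hC hy hx]

theorem gramShift_apply_notMem_notMem (hC : ∀ x y, C x y ≠ 0 → x ∈ U ∧ y ∉ U) {x y : Fin n}
    (hx : x ∉ U) (hy : y ∉ U) : gramShift U C τ x y = if x = y then 1 else 0 := by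
  have h : (C * Cᵀ) x y = 0 := by
    rw [Matrix.mul_apply]
    exact Finset.sum_eq_zero fun z _ => by
      rw [Matrix.transpose_apply, eq_zero_of_notMem_left hC hy, mul_zero]
  rw [gramShift_apply hC, h, eq_zero_of_notMem_left hC hx, eq_zero_of_notMem_left hC hy]
  simp [hx]

theorem isDescribedBy_gramShift (hC : ∀ x y, C x y ≠ 0 → x ∈ U ∧ y ∉ U) {G : SimpleGraph (Fin n)}
    (hUU : ∀ x ∈ U, ∀ y ∈ U, x ≠ y → ((C * Cᵀ) x y + τ ≠ 0 ↔ G.Adj x y))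
    (hUW : ∀ x ∈ U, ∀ y ∉ U, (C x y ≠ 0 ↔ G.Adj x y))
    (hWW : ∀ x ∉ U, ∀ y ∉ U, ¬ G.Adj x y) : IsDescribedBy (gramShift U C τ) G where
  symm := gramShift_isSymm
  graph x y hxy := by
    by_cases hx : x ∈ U <;> by_cases hy : y ∈ U
    · rw [gramShift_apply_mem_mem hC hx hy, hUU x hx y hy hxy]
    · rw [gramShift_apply_mem_notMem hC hx hy, hUW x hx y hy]
    · rw [gramShift_apply_notMem_mem hC hx hy, hUW y hy x hx, G.adj_comm]
    · rw [gramShift_apply_notMem_notMem hC hx hy, if_neg hxy]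
      simpa using hWW x hx y hy

theorem gramShift_nonpos (hC : ∀ x y, C x y ≠ 0 → x ∈ U ∧ y ∉ U)
    (hUU : ∀ x ∈ U, ∀ y ∈ U, x ≠ y → (C * Cᵀ) x y + τ ≤ 0) (hUW : ∀ x y, C x y ≤ 0) (x y : Fin n)
    (hxy : x ≠ y) : gramShift U C τ x y ≤ 0 := by
  by_cases hx : x ∈ U <;> by_cases hy : y ∈ U
  · rw [gramShift_apply_mem_mem hC hx hy]; exact hUU x hx y hy hxy
  · rw [gramShift_apply_mem_notMem hC hx hy]; exact hUW x y
  · rw [gramShift_apply_notMem_mem hC hx hy]; exact hUW y x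
  · rw [gramShift_apply_notMem_notMem hC hx hy, if_neg hxy]

theorem mul_gramShift_row (hC : ∀ x y, C x y ≠ 0 → x ∈ U ∧ y ∉ U) {X : Matrix (Fin n) (Fin n) ℝ}
    (hX : gramShift U C τ * X = 0) {x : Fin n} (hx : x ∉ U) (y : Fin n) :
    X x y = -∑ u, C u x * X u y := by
  have h := congrFun (congrFun hX x) y
  rw [Matrix.mul_apply, Matrix.zero_apply] at h
  have h1 : ∀ u, gramShift U C τ x u * X u y = C u x * X u y + if x = u then X u y else 0 := by
    intro u
    by_cases hu : u ∈ U
    · rw [gramShift_apply_notMem_mem hC hx hu, if_neg (fun h : x = u => hx (h.symm ▸ hu)), add_zero]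
    · rw [gramShift_apply_notMem_notMem hC hx hu, eq_zero_of_notMem_left hC hu]
      split_ifs <;> simp
  rw [Finset.sum_congr rfl fun u _ => h1 u, Finset.sum_add_distrib, Finset.sum_ite_eq,
    if_pos (Finset.mem_univ _)] at h
  linarith

/-- The identity block lets `A * X = 0` express the rows of `X` outside `U` through those in `U`.
With the symmetry of `X`, vanishing on `U × U` therefore spreads to all of `X`. -/
theorem strongArnold_gramShift (hC : ∀ x y, C x y ≠ 0 → x ∈ U ∧ y ∉ U) {G : SimpleGraph (Fin n)}
    (hG : IsDescribedBy (gramShift U C τ) G)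
    (h : ∀ X : Matrix (Fin n) (Fin n) ℝ, (∀ x ∉ U, ∀ y, X x y = -∑ u, C u x * X u y) →
      (∀ x, X x x = 0) → (∀ x y, G.Adj x y → X x y = 0) → ∀ x ∈ U, ∀ y ∈ U, X x y = 0) :
    StrongArnold (gramShift U C τ) := by
  rintro ⟨X, hne, hXs, hAX, hAX', hIX⟩
  refine hne ?_
  have hrow : ∀ x ∉ U, ∀ y, X x y = -∑ u, C u x * X u y := fun x hx y =>
    mul_gramShift_row hC hAX hx y
  have h0 := h X hrow (fun x => by simpa using congrFun (congrFun hIX x) x) fun x y hxy => by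
    have := congrFun (congrFun hAX' x) y
    rw [Matrix.hadamard_apply, Matrix.zero_apply] at this
    exact (mul_eq_zero.1 this).resolve_left ((hG.graph x y hxy.ne).2 hxy)
  have key : ∀ y, (∀ x ∈ U, X x y = 0) → ∀ x, X x y = 0 := fun y hy x => by
    by_cases hx : x ∈ U
    · exact hy x hx
    · rw [hrow x hx y, Finset.sum_eq_zero, neg_zero]
      intro u _
      by_cases hu : u ∈ U
      · rw [hy u hu, mul_zero]
      · rw [eq_zero_of_notMem_left hC hu, zero_mul]
  have h1 : ∀ y ∈ U, ∀ x, X x y = 0 := fun y hy => key y fun x hx => h0 x hx y hy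
  ext x y
  exact key y (fun x hx => by rw [← hXs.apply]; exact h1 x hx y) x

theorem posSemidef_gramShift (hτ : 0 ≤ τ) : (gramShift U C τ).PosSemidef := by
  refine Matrix.PosSemidef.add ?_ (Matrix.PosSemidef.smul ?_ hτ)
  · have := Matrix.posSemidef_self_mul_conjTranspose
      (C + Matrix.diagonal fun x => if x ∈ U then (0 : ℝ) else 1)
    rwa [Matrix.conjTranspose_eq_transpose_of_trivial] at this
  · have := Matrix.posSemidef_vecMulVec_self_star (fun x => if x ∈ U then (1 : ℝ) else 0)
    rwa [star_trivial] at this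

theorem gramShift_mulVec (x : Fin n → ℝ) : gramShift U C τ *ᵥ x =
    (C + Matrix.diagonal fun x => if x ∈ U then 0 else 1) *ᵥ
      ((C + Matrix.diagonal fun x => if x ∈ U then 0 else 1)ᵀ *ᵥ x) +
    (τ * ((fun x => if x ∈ U then 1 else 0) ⬝ᵥ x)) • fun x => if x ∈ U then 1 else 0 := by
  rw [gramShift, Matrix.add_mulVec, Matrix.smul_mulVec, Matrix.mulVec_mulVec,
    Matrix.vecMulVec_mulVec, ← smul_smul]
  simp

/-- A sum of squares plus `τ` times one further square: only the last term can be negative. -/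
theorem gramShift_form (x : Fin n → ℝ) : x ⬝ᵥ gramShift U C τ *ᵥ x =
    ((C + Matrix.diagonal fun x => if x ∈ U then 0 else 1)ᵀ *ᵥ x) ⬝ᵥ
      ((C + Matrix.diagonal fun x => if x ∈ U then 0 else 1)ᵀ *ᵥ x) +
    τ * ((fun x => if x ∈ U then 1 else 0) ⬝ᵥ x) ^ 2 := by
  rw [gramShift_mulVec, dotProduct_add, dotProduct_smul, Matrix.dotProduct_mulVec,
    ← Matrix.mulVec_transpose, dotProduct_comm x (fun x => if x ∈ U then (1 : ℝ) else 0),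
    smul_eq_mul]
  ring

theorem oneNegEigenvalue_gramShift (hC : ∀ x y, C x y ≠ 0 → x ∈ U ∧ y ∉ U) (hU : U.Nonempty)
    (hτ : τ < 0) : OneNegEigenvalue (gramShift U C τ) := by
  set e : Fin n → ℝ := fun x => if x ∈ U then 1 else 0 with he
  -- The vector `e - Cᵀ *ᵥ e` kills the sum of squares and has inner product `U.card` with `e`.
  refine oneNegEigenvalue_of_form gramShift_isSymm (w := e) (z := e - Cᵀ *ᵥ e) ?_ ?_
  · have h0 : ∀ x ∈ U, (Cᵀ *ᵥ e) x = 0 := fun x hx => by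
      simp only [Matrix.mulVec, dotProduct, Matrix.transpose_apply]
      exact Finset.sum_eq_zero fun y _ => by rw [eq_zero_of_mem_right hC hx, zero_mul]
    have h1 : (C + Matrix.diagonal fun x => if x ∈ U then (0 : ℝ) else 1)ᵀ *ᵥ
        (e - Cᵀ *ᵥ e) = 0 := by
      have h2 : Cᵀ *ᵥ (Cᵀ *ᵥ e) = 0 := by
        ext x
        simp only [Matrix.mulVec, dotProduct, Matrix.transpose_apply, Pi.zero_apply]
        refine Finset.sum_eq_zero fun y _ => ?_
        by_cases hy : y ∈ U
        · have := h0 y hy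
          simp only [Matrix.mulVec, dotProduct, Matrix.transpose_apply] at this
          rw [this, mul_zero]
        · rw [eq_zero_of_notMem_left hC hy, zero_mul]
      rw [Matrix.transpose_add, Matrix.add_mulVec, Matrix.mulVec_sub, h2, Matrix.diagonal_transpose]
      ext x
      simp only [Pi.add_apply, Pi.sub_apply, Pi.zero_apply, Matrix.mulVec_diagonal]
      by_cases hx : x ∈ U
      · simp [hx, h0 x hx]
      · simp [hx, he]
    have h3 : e ⬝ᵥ (e - Cᵀ *ᵥ e) = U.card := by
      have : ∀ x, e x * (e - Cᵀ *ᵥ e) x = if x ∈ U then 1 else 0 := fun x => by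
        by_cases hx : x ∈ U
        · simp [he, hx]
          exact h0 x hx
        · simp [he, hx]
      simp only [dotProduct, this]
      simp
    rw [gramShift_form, h1, dotProduct_zero, zero_add, ← he, h3]
    have : (0 : ℝ) < U.card := by exact_mod_cast hU.card_pos
    exact mul_neg_of_neg_of_pos hτ (by positivity)
  · intro x hx
    rw [gramShift_form, ← he, hx]
    simp only [ne_eq, OfNat.ofNat_ne_zero, not_false_eq_true, zero_pow, mul_zero, add_zero]
    exact Finset.sum_nonneg fun i _ => mul_self_nonneg _

/-- The kernel contains the solutions of `n - U.card` equations from the Gram factor, whose columns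
indexed by `U` vanish, and one more equation for the rank-one shift. -/
theorem card_le_nullity_gramShift (hC : ∀ x y, C x y ≠ 0 → x ∈ U ∧ y ∉ U) :
    U.card ≤ nullity (gramShift U C τ) + 1 := by
  classical
  set M := C + Matrix.diagonal fun x => if x ∈ U then (0 : ℝ) else 1 with hM
  set e : Fin n → ℝ := fun x => if x ∈ U then 1 else 0 with he
  let T : (Fin n → ℝ) →ₗ[ℝ] (↥Uᶜ → ℝ) × ℝ :=
    (LinearMap.funLeft ℝ ℝ (Subtype.val : ↥Uᶜ → Fin n) ∘ₗ Mᵀ.mulVecLin).prod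
      (dotProductBilin ℝ ℝ e)
  have hker : LinearMap.ker T ≤ LinearMap.ker (gramShift U C τ).mulVecLin := by
    intro x hx
    rw [LinearMap.mem_ker] at hx ⊢
    have h2 : e ⬝ᵥ x = 0 := congrArg Prod.snd hx
    have h1 : Mᵀ *ᵥ x = 0 := by
      ext y
      by_cases hy : y ∈ U
      · simp only [Matrix.mulVec, dotProduct, Matrix.transpose_apply, Pi.zero_apply]
        refine Finset.sum_eq_zero fun z _ => ?_
        rw [hM, Matrix.add_apply, eq_zero_of_mem_right hC hy, Matrix.diagonal_apply]
        split_ifs with h3 h4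
        · simp
        · exact absurd (h3 ▸ hy) h4
        · simp
      · exact congrFun (congrArg Prod.fst hx) ⟨y, Finset.mem_compl.2 hy⟩
    rw [Matrix.mulVecLin_apply, gramShift_mulVec, ← hM, ← he, h1, h2]
    simp
  have h1 := Submodule.finrank_mono hker
  have h2 := LinearMap.finrank_range_add_finrank_ker T
  have h3 := Submodule.finrank_le (LinearMap.range T)
  rw [Module.finrank_prod, Module.finrank_fintype_fun_eq_card, Module.finrank_self,
    Fintype.card_coe, Finset.card_compl, Fintype.card_fin] at h3
  rw [Module.finrank_fintype_fun_eq_card, Fintype.card_fin] at h2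
  have h4 := Finset.card_le_univ U
  rw [Fintype.card_fin] at h4
  unfold nullity
  omega

end GramShift

/-! ### Lower bounds for graphs with a large clique or complete bipartite graph -/

theorem nullity_le_xi {n : ℕ} {G : SimpleGraph (Fin n)} {A : Matrix (Fin n) (Fin n) ℝ}
    (h1 : IsDescribedBy A G) (h2 : StrongArnold A) : nullity A ≤ xi n G :=
  le_csSup ⟨n, fun _ ⟨B, _, _, h⟩ => h ▸ nullity_le B⟩ ⟨A, h1, h2, rfl⟩

theorem nullity_le_nu {n : ℕ} {G : SimpleGraph (Fin n)} {A : Matrix (Fin n) (Fin n) ℝ}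
    (h1 : IsDescribedBy A G) (h2 : StrongArnold A) (h3 : A.PosSemidef) : nullity A ≤ nu n G :=
  le_csSup ⟨n, fun _ ⟨B, _, _, _, h⟩ => h ▸ nullity_le B⟩ ⟨A, h1, h2, h3, rfl⟩

theorem nullity_le_mu {n : ℕ} {G : SimpleGraph (Fin n)} {A : Matrix (Fin n) (Fin n) ℝ}
    (h1 : IsDescribedBy A G) (h2 : StrongArnold A) (h3 : OneNegEigenvalue A)
    (h4 : ∀ i j, i ≠ j → A i j ≤ 0) : nullity A ≤ mu n G :=
  le_csSup ⟨n, fun _ ⟨B, _, _, _, _, h⟩ => h ▸ nullity_le B⟩ ⟨A, h1, h2, h3, h4, rfl⟩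

/-- The vertices in `U` are pairwise adjacent, and every edge meets `U`. -/
structure IsCoveringClique {n : ℕ} (G : SimpleGraph (Fin n)) (U : Finset (Fin n)) : Prop where
  clique : ∀ x ∈ U, ∀ y ∈ U, x ≠ y → G.Adj x y
  cover : ∀ x ∉ U, ∀ y ∉ U, ¬ G.Adj x y

/-- Take `C` to be minus the adjacency between `U` and its complement. The condition on `τ` keeps
all entries inside the clique nonzero, and the Strong Arnold Property is immediate because every
position in `U × U` is diagonal or an edge. -/
theorem IsCoveringClique.exists_gramShift {n : ℕ} {G : SimpleGraph (Fin n)} {U : Finset (Fin n)}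
    (h : IsCoveringClique G U) : ∃ C : Matrix (Fin n) (Fin n) ℝ,
      (∀ x y, C x y ≠ 0 → x ∈ U ∧ y ∉ U) ∧ (∀ x y, C x y ≤ 0) ∧
      (∀ x y, 0 ≤ (C * Cᵀ) x y ∧ (C * Cᵀ) x y ≤ n) ∧
      ∀ τ : ℝ, (∀ x y, (C * Cᵀ) x y + τ ≠ 0) → IsDescribedBy (gramShift U C τ) G ∧
        StrongArnold (gramShift U C τ) := by
  classical
  set C : Matrix (Fin n) (Fin n) ℝ :=
    Matrix.of fun x y => if x ∈ U ∧ y ∉ U ∧ G.Adj x y then -1 else 0 with hCdef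
  have hCapp : ∀ x y, C x y = if x ∈ U ∧ y ∉ U ∧ G.Adj x y then -1 else 0 := fun _ _ => rfl
  have hC : ∀ x y, C x y ≠ 0 → x ∈ U ∧ y ∉ U := fun x y hxy => by
    rw [hCapp] at hxy
    by_contra hcon
    exact hxy (if_neg fun h => hcon ⟨h.1, h.2.1⟩)
  refine ⟨C, hC, fun x y => ?_, fun x y => ?_, fun τ hτ => ?_⟩
  · rw [hCapp]; split_ifs <;> norm_num
  · rw [Matrix.mul_apply]
    have hterm : ∀ z, 0 ≤ C x z * Cᵀ z y ∧ C x z * Cᵀ z y ≤ 1 := fun z => by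
      rw [Matrix.transpose_apply, hCapp, hCapp]
      split_ifs <;> norm_num
    refine ⟨Finset.sum_nonneg fun z _ => (hterm z).1, ?_⟩
    exact (Finset.sum_le_sum fun z _ => (hterm z).2).trans (by simp)
  · have hG : IsDescribedBy (gramShift U C τ) G := by
      refine isDescribedBy_gramShift hC (fun x hx y hy hxy => ?_) (fun x hx y hy => ?_) h.cover
      · exact iff_of_true (hτ x y) (h.clique x hx y hy hxy)
      · rw [hCapp]; simp [hx, hy]
    refine ⟨hG, strongArnold_gramShift hC hG fun X _ hX hXG x hx y hy => ?_⟩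
    by_cases hxy : x = y
    · exact hxy ▸ hX x
    · exact hXG x y (h.clique x hx y hy hxy)

theorem IsCoveringClique.card_le_nu {n : ℕ} {G : SimpleGraph (Fin n)} {U : Finset (Fin n)}
    (h : IsCoveringClique G U) : U.card ≤ nu n G + 1 := by
  obtain ⟨C, hC, -, hCC, hA⟩ := h.exists_gramShift
  obtain ⟨h1, h2⟩ := hA 1 fun x y => by have := (hCC x y).1; positivity
  exact (card_le_nullity_gramShift hC).trans
    (Nat.succ_le_succ (nullity_le_nu h1 h2 (posSemidef_gramShift zero_le_one)))

theorem IsCoveringClique.card_le_xi {n : ℕ} {G : SimpleGraph (Fin n)} {U : Finset (Fin n)}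
    (h : IsCoveringClique G U) : U.card ≤ xi n G + 1 := by
  obtain ⟨C, hC, -, hCC, hA⟩ := h.exists_gramShift
  obtain ⟨h1, h2⟩ := hA 1 fun x y => by have := (hCC x y).1; positivity
  exact (card_le_nullity_gramShift hC).trans (Nat.succ_le_succ (nullity_le_xi h1 h2))

theorem IsCoveringClique.card_le_mu {n : ℕ} {G : SimpleGraph (Fin n)} {U : Finset (Fin n)}
    (h : IsCoveringClique G U) : U.card ≤ mu n G + 1 := by
  obtain ⟨C, hC, hC0, hCC, hA⟩ := h.exists_gramShift
  have hneg : ∀ x y, (C * Cᵀ) x y + (-(n + 1) : ℝ) < 0 := fun x y => by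
    have := (hCC x y).2; linarith
  -- The entries of `C * Cᵀ` are at most `n`, so this shift makes all entries on `U × U` negative.
  obtain ⟨h1, h2⟩ := hA (-(n + 1)) fun x y => (hneg x y).ne
  rcases U.eq_empty_or_nonempty with rfl | hU
  · simp
  · exact (card_le_nullity_gramShift hC).trans (Nat.succ_le_succ (nullity_le_mu h1 h2
      (oneNegEigenvalue_gramShift hC hU (by have : (0 : ℝ) ≤ n := Nat.cast_nonneg n; linarith))
      (gramShift_nonpos hC (fun x _ y _ _ => (hneg x y).le) hC0)))

theorem IsCoveringClique.card_le_hadwiger {n : ℕ} {G : SimpleGraph (Fin n)} {U : Finset (Fin n)}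
    (h : IsCoveringClique G U) : U.card ≤ hadwiger n G + 1 := by
  refine le_trans ?_ (Nat.le_succ _)
  let e := U.equivFin.symm
  refine le_csSup (bddAbove_isMinor G) ⟨fun w => {(e w).1}, fun w => ?_, fun w w' hw => ?_,
    fun w w' hw => ?_⟩
  · exact { preconnected := .of_subsingleton, nonempty := ⟨⟨_, rfl⟩⟩ }
  · exact Set.disjoint_singleton.2 fun h => hw (e.injective (Subtype.ext h))
  · exact ⟨_, rfl, _, rfl, h.clique _ (e w).2 _ (e w').2 fun h => hw (e.injective (Subtype.ext h))⟩

/-- The edges of `G` are those of a complete bipartite graph with sides given by `a` and `b`. -/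
structure IsBiclique {n m : ℕ} (G : SimpleGraph (Fin n)) (a b : Fin m → Fin n) : Prop where
  left_inj : Function.Injective a
  right_inj : Function.Injective b
  ne : ∀ s t, a s ≠ b t
  adj : ∀ x y, G.Adj x y ↔ (∃ s t, x = a s ∧ y = b t) ∨ ∃ s t, x = b t ∧ y = a s

/-- Inside `U` there must be no edges, so the rows of `C` need pairwise inner product `-τ`. The
block `α (I - β J)` has this property for the stated `τ`; it has no zero entry since `β ≠ 0, 1`, and
it is invertible since `m * β ≠ 1`, which yields the Strong Arnold Property. -/
theorem IsBiclique.exists_gramShift {n m : ℕ} {G : SimpleGraph (Fin n)} {a b : Fin m → Fin n}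
    (h : IsBiclique G a b) {α β τ : ℝ} (hα : α ^ 2 = 1) (hβ0 : β ≠ 0) (hβ1 : β ≠ 1)
    (hmβ : m * β ≠ 1) (hτ : τ = 2 * β - m * β ^ 2) :
    ∃ (U : Finset (Fin n)) (C : Matrix (Fin n) (Fin n) ℝ), U.card = m ∧
      (∀ x y, C x y ≠ 0 → x ∈ U ∧ y ∉ U) ∧
      (∀ x y, C x y = 0 ∨ C x y = α * (1 - β) ∨ C x y = -(α * β)) ∧
      (∀ x ∈ U, ∀ y ∈ U, x ≠ y → (C * Cᵀ) x y + τ = 0) ∧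
      IsDescribedBy (gramShift U C τ) G ∧ StrongArnold (gramShift U C τ) := by
  classical
  have hα0 : α ≠ 0 := by rintro rfl; norm_num at hα
  set B : Fin m → Fin m → ℝ := fun s t => α * ((if s = t then 1 else 0) - β) with hB
  have hB0 : ∀ s t, B s t ≠ 0 := fun s t => by
    refine mul_ne_zero hα0 ?_
    split_ifs
    · exact sub_ne_zero.2 (Ne.symm hβ1)
    · simpa using hβ0
  obtain ⟨C, hCab, hCsupp⟩ : ∃ C : Matrix (Fin n) (Fin n) ℝ, (∀ s t, C (a s) (b t) = B s t) ∧
      ∀ x y, C x y ≠ 0 → ∃ s t, x = a s ∧ y = b t := by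
    refine ⟨Matrix.of fun x y => ∑ s, ∑ t, if x = a s ∧ y = b t then B s t else 0,
      fun s t => ?_, fun x y hxy => ?_⟩
    · simp only [Matrix.of_apply, h.left_inj.eq_iff, h.right_inj.eq_iff]
      rw [Finset.sum_eq_single s (fun s' _ hs' => Finset.sum_eq_zero fun t' _ =>
        if_neg fun h => hs' h.1.symm) (by simp), Finset.sum_eq_single t
        (fun t' _ ht' => if_neg fun h => ht' h.2.symm) (by simp), if_pos ⟨rfl, rfl⟩]
    · rw [Matrix.of_apply] at hxy
      obtain ⟨s, -, hs⟩ := Finset.exists_ne_zero_of_sum_ne_zero hxy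
      obtain ⟨t, -, ht⟩ := Finset.exists_ne_zero_of_sum_ne_zero hs
      exact ⟨s, t, by by_contra hcon; exact ht (if_neg hcon)⟩
  set U := Finset.univ.image a with hU
  have hUmem : ∀ {x}, x ∈ U ↔ ∃ s, x = a s := fun {x} => by simp [hU, eq_comm]
  have hbU : ∀ t, b t ∉ U := fun t ht => by
    obtain ⟨s, hs⟩ := hUmem.1 ht
    exact h.ne s t hs.symm
  have hC : ∀ x y, C x y ≠ 0 → x ∈ U ∧ y ∉ U := fun x y hxy => by
    obtain ⟨s, t, rfl, rfl⟩ := hCsupp x y hxy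
    exact ⟨hUmem.2 ⟨s, rfl⟩, hbU t⟩
  have hCC : ∀ x ∈ U, ∀ y ∈ U, x ≠ y → (C * Cᵀ) x y + τ = 0 := by
    intro x hx y hy hxy
    obtain ⟨s, rfl⟩ := hUmem.1 hx
    obtain ⟨s', rfl⟩ := hUmem.1 hy
    have hss' : s ≠ s' := fun h => hxy (congrArg a h)
    have h1 : (C * Cᵀ) (a s) (a s') = ∑ t, B s t * B s' t := by
      rw [Matrix.mul_apply]
      symm
      refine Finset.sum_of_injOn b h.right_inj.injOn (fun _ _ => Finset.mem_coe.2 (Finset.mem_univ _))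
        (fun z _ hz => ?_) (fun t _ => ?_)
      · rw [Matrix.transpose_apply]
        by_contra hne
        obtain ⟨_, t, -, ht⟩ := hCsupp _ _ (left_ne_zero_of_mul hne)
        exact hz ⟨t, by simp, ht.symm⟩
      · rw [Matrix.transpose_apply, hCab, hCab]
    have h2 : ∀ t, B s t * B s' t = -β * (if s = t then 1 else 0) - β * (if s' = t then 1 else 0)
        + β ^ 2 := fun t => by
      have h3 : (if s = t then (1 : ℝ) else 0) * (if s' = t then 1 else 0) = 0 := by
        split_ifs with h4 h5
        · exact absurd (h4.trans h5.symm) hss'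
        all_goals simp
      simp only [hB]
      linear_combination ((if s = t then (1 : ℝ) else 0) - β) * ((if s' = t then 1 else 0) - β) * hα
        + h3
    rw [h1, Finset.sum_congr rfl fun t _ => h2 t, Finset.sum_add_distrib, Finset.sum_sub_distrib,
      ← Finset.mul_sum, ← Finset.mul_sum, hτ]
    simp
    ring
  have hG : IsDescribedBy (gramShift U C τ) G := by
    refine isDescribedBy_gramShift hC (fun x hx y hy hxy => ?_) (fun x hx y hy => ?_)
      fun x hx y hy hxy => ?_
    · refine iff_of_false (fun h1 => h1 (hCC x hx y hy hxy)) fun h1 => ?_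
      rcases (h.adj x y).1 h1 with ⟨s, t, -, rfl⟩ | ⟨s, t, rfl, -⟩
      · exact hbU t hy
      · exact hbU t hx
    · refine ⟨fun h1 => (h.adj x y).2 (Or.inl (hCsupp x y h1)), fun h1 => ?_⟩
      rcases (h.adj x y).1 h1 with ⟨s, t, rfl, rfl⟩ | ⟨s, t, rfl, rfl⟩
      · rw [hCab]; exact hB0 s t
      · exact absurd hx (hbU t)
    · rcases (h.adj x y).1 hxy with ⟨s, t, rfl, -⟩ | ⟨s, t, -, rfl⟩
      · exact hx (hUmem.2 ⟨s, rfl⟩)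
      · exact hy (hUmem.2 ⟨s, rfl⟩)
  refine ⟨U, C, ?_, hC, fun x y => ?_, hCC, hG, strongArnold_gramShift hC hG ?_⟩
  · rw [hU, Finset.card_image_of_injective _ h.left_inj]; simp
  · by_cases h0 : C x y = 0
    · exact Or.inl h0
    · obtain ⟨s, t, rfl, rfl⟩ := hCsupp x y h0
      rw [hCab]
      simp only [hB]
      split_ifs
      · exact Or.inr (Or.inl rfl)
      · exact Or.inr (Or.inr (by ring))
  · intro X hrow _ hXG x hx y hy
    obtain ⟨s, rfl⟩ := hUmem.1 hx
    obtain ⟨s', rfl⟩ := hUmem.1 hy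
    set S := ∑ s, X (a s) (a s') with hS
    -- Since `b t` and `a s'` are adjacent, `X` vanishes there, so the row equation at `b t` becomes
    -- an equation for `X` on the left side alone. Summing the resulting identity over `t` gives `S
    -- = m * β * S`.
    have h1 : ∀ t, X (a t) (a s') = β * S := fun t => by
      have h2 := hrow (b t) (hbU t) (a s')
      rw [hXG _ _ ((h.adj _ _).2 (Or.inr ⟨s', t, rfl, rfl⟩))] at h2
      have h3 : ∑ u, C u (b t) * X u (a s') = ∑ s, B s t * X (a s) (a s') := by
        symm
        refine Finset.sum_of_injOn a h.left_inj.injOn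
          (fun _ _ => Finset.mem_coe.2 (Finset.mem_univ _)) (fun z _ hz => ?_) (fun s _ => ?_)
        · by_contra hne
          obtain ⟨s, _, hs, -⟩ := hCsupp _ _ (left_ne_zero_of_mul hne)
          exact hz ⟨s, by simp, hs.symm⟩
        · rw [hCab]
      have h4 : ∑ s, B s t * X (a s) (a s') = α * (X (a t) (a s') - β * S) := by
        simp only [hB, hS, mul_assoc, sub_mul, ← Finset.mul_sum, Finset.sum_sub_distrib]
        simp
      rw [h3, h4] at h2
      have := (mul_eq_zero.1 (neg_eq_zero.1 h2.symm)).resolve_left hα0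
      linarith
    have h5 : S = m * β * S := by
      calc S = ∑ t, X (a t) (a s') := rfl
        _ = ∑ _t : Fin m, β * S := Finset.sum_congr rfl fun t _ => h1 t
        _ = m * β * S := by simp [mul_assoc]
    have h6 : S = 0 := by
      by_contra h0
      exact hmβ (mul_right_cancel₀ h0 (by rw [one_mul]; exact h5.symm))
    rw [h1, h6, mul_zero]

theorem IsBiclique.exists_gramShift_psd {n m : ℕ} {G : SimpleGraph (Fin n)} {a b : Fin m → Fin n}
    (h : IsBiclique G a b) (hm : 3 ≤ m) : ∃ A, IsDescribedBy A G ∧ StrongArnold A ∧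
      A.PosSemidef ∧ m ≤ nullity A + 1 := by
  have hm0 : (3 : ℝ) ≤ m := by exact_mod_cast hm
  have hne : (m : ℝ) ≠ 0 := by positivity
  -- The block `I - (2 / m) J` is a Householder reflection: its rows are orthogonal, so no shift is
  -- needed.
  obtain ⟨U, C, hU, hC, -, -, h1, h2⟩ := h.exists_gramShift (α := 1) (β := 2 / m) (τ := 0)
    (by norm_num) (by positivity) (by rw [ne_eq, div_eq_one_iff_eq hne]; linarith)
    (by rw [mul_div_cancel₀ _ hne]; norm_num) (by field_simp; ring)
  exact ⟨_, h1, h2, posSemidef_gramShift le_rfl, hU ▸ card_le_nullity_gramShift hC⟩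

theorem IsBiclique.le_nu {n m : ℕ} {G : SimpleGraph (Fin n)} {a b : Fin m → Fin n}
    (h : IsBiclique G a b) (hm : 3 ≤ m) : m ≤ nu n G + 1 := by
  obtain ⟨A, h1, h2, h3, h4⟩ := h.exists_gramShift_psd hm
  exact h4.trans (Nat.succ_le_succ (nullity_le_nu h1 h2 h3))

theorem IsBiclique.le_xi {n m : ℕ} {G : SimpleGraph (Fin n)} {a b : Fin m → Fin n}
    (h : IsBiclique G a b) (hm : 3 ≤ m) : m ≤ xi n G + 1 := by
  obtain ⟨A, h1, h2, -, h4⟩ := h.exists_gramShift_psd hm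
  exact h4.trans (Nat.succ_le_succ (nullity_le_xi h1 h2))

theorem IsBiclique.le_mu {n m : ℕ} {G : SimpleGraph (Fin n)} {a b : Fin m → Fin n}
    (h : IsBiclique G a b) (hm : 3 ≤ m) : m ≤ mu n G + 1 := by
  have hm0 : (3 : ℝ) ≤ m := by exact_mod_cast hm
  -- The block `-(I + J)` has only negative entries, and its rows have inner product `m + 2`, whence
  -- `τ < 0`.
  obtain ⟨U, C, hU, hC, hC0, hCC, h1, h2⟩ := h.exists_gramShift (α := -1) (β := -1)
    (τ := 2 * (-1) - m * (-1) ^ 2) (by norm_num) (by norm_num) (by norm_num)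
    (by linarith) rfl
  refine (hU ▸ card_le_nullity_gramShift hC).trans (Nat.succ_le_succ (nullity_le_mu h1 h2
    (oneNegEigenvalue_gramShift hC (Finset.card_pos.1 (by omega)) (by linarith))
    (gramShift_nonpos hC (fun x hx y hy hxy => (hCC x hx y hy hxy).le) fun x y => ?_)))
  rcases hC0 x y with h | h | h <;> rw [h] <;> norm_num

/-- Contract the perfect matching `a w`, `b w`. -/
theorem IsBiclique.le_hadwiger {n m : ℕ} {G : SimpleGraph (Fin n)} {a b : Fin m → Fin n}
    (h : IsBiclique G a b) : m ≤ hadwiger n G + 1 := by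
  refine le_trans ?_ (Nat.le_succ _)
  have hab : ∀ s t, G.Adj (a s) (b t) := fun s t => (h.adj _ _).2 (Or.inl ⟨s, t, rfl, rfl⟩)
  refine le_csSup (bddAbove_isMinor G) ⟨fun w => {a w, b w}, fun w => ?_, fun w w' hw => ?_,
    fun w w' hw => ⟨a w, by simp, b w', by simp, hab w w'⟩⟩
  · exact SimpleGraph.induce_pair_connected_of_adj (hab w w)
  · refine Set.disjoint_left.2 ?_
    rintro x (rfl | rfl) (h1 | h1)
    · exact hw (h.left_inj h1)
    · exact h.ne _ _ h1
    · exact h.ne _ _ h1.symm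
    · exact hw (h.right_inj h1)

/-! ### A decomposition into large cliques and complete bipartite graphs -/

/-- The classes are the residues modulo `q`. Each colour from `q` on owns a pair of distinct classes
and takes the edges between their first `m` members. Every other edge goes to the smaller of the
classes of its ends, so each colour `c < q` contains all edges inside class `c` and only edges that
meet it. -/
theorem exists_decomposition_cliques_bicliques {q r n m : ℕ} (hq : 0 < q) (hqr : q ≤ r)
    (hr : r ≤ q + q.choose 2) (hm : m * q ≤ n) :
    ∃ G : Fin r → SimpleGraph (Fin n), IsDecomposition G ∧
      ∀ c, (∃ U, m ≤ U.card ∧ IsCoveringClique (G c) U) ∨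
        ∃ a b : Fin m → Fin n, IsBiclique (G c) a b := by
  classical
  obtain ⟨f⟩ : Nonempty ({c : Fin r // q ≤ c.val} ↪ {e : Sym2 (Fin q) // ¬ e.IsDiag}) := by
    refine Function.Embedding.nonempty_of_card_le ?_
    rw [Sym2.card_subtype_not_diag, Fintype.card_fin]
    have h1 : Fintype.card {c : Fin r // q ≤ c.val} ≤ Fintype.card (Fin (r - q)) :=
      Fintype.card_le_of_injective (fun c => ⟨c.1.val - q, by have := c.1.isLt; have := c.2; omega⟩)
        fun c d hcd => by
          have h2 := Fin.val_eq_of_eq hcd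
          have := c.2
          have := d.2
          dsimp only at h2
          exact Subtype.ext (Fin.ext (by omega))
    rw [Fintype.card_fin] at h1
    omega
  let p : Fin n → Fin q := fun x => ⟨x.val % q, Nat.mod_lt _ hq⟩
  have hp : ∀ x, (p x).val = x.val % q := fun _ => rfl
  -- The quotient `x.val / q` is the position of `x` in its residue class. Truncating at `m` makes
  -- the bipartite graphs balanced when classes have different sizes.
  let P : Sym2 (Fin n) → {c : Fin r // q ≤ c.val} → Prop := fun e c =>
    (f c).1 = e.map p ∧ ∀ x ∈ e, x.val / q < m
  let κ : Sym2 (Fin n) → Fin r := fun e =>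
    if h : ∃ c, P e c then h.choose.1 else ⟨(e.map p).inf.val, (e.map p).inf.isLt.trans_le hqr⟩
  have hκ_large : ∀ e (c : {c : Fin r // q ≤ c.val}), κ e = c.1 ↔ P e c := by
    intro e c
    have huniq : ∀ c', P e c' → P e c → c' = c := fun c' h h' =>
      f.injective (Subtype.ext (h.1.trans h'.1.symm))
    by_cases h : ∃ c, P e c
    · have h1 : κ e = h.choose.1 := dif_pos h
      rw [h1]
      refine ⟨fun h2 => ?_, fun h2 => by rw [huniq _ h.choose_spec h2]⟩
      have h3 : h.choose = c := Subtype.ext h2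
      exact h3 ▸ h.choose_spec
    · have h1 : κ e = ⟨(e.map p).inf.val, (e.map p).inf.isLt.trans_le hqr⟩ := dif_neg h
      rw [h1]
      refine ⟨fun h2 => ?_, fun h2 => absurd ⟨c, h2⟩ h⟩
      have := c.2
      rw [← h2] at this
      exact absurd (e.map p).inf.isLt (not_lt.2 this)
  have hκ_small : ∀ e (c : Fin r), c.val < q → κ e = c → (e.map p).inf.val = c.val := by
    intro e c hc h
    by_cases h' : ∃ c, P e c
    · have h1 : κ e = h'.choose.1 := dif_pos h'
      have h2 := h'.choose.2
      rw [← h1, h] at h2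
      omega
    · have h1 : κ e = ⟨(e.map p).inf.val, (e.map p).inf.isLt.trans_le hqr⟩ := dif_neg h'
      rw [← h, h1]
  have hκ_diag : ∀ e, (e.map p).IsDiag → (κ e).val = (e.map p).inf.val := by
    intro e he
    have h' : ¬ ∃ c, P e c := fun ⟨c, hc⟩ => (f c).2 (hc.1 ▸ he)
    have h1 : κ e = ⟨(e.map p).inf.val, (e.map p).inf.isLt.trans_le hqr⟩ := dif_neg h'
    rw [h1]
  refine ⟨colorClass κ, isDecomposition_colorClass κ, fun c => ?_⟩
  by_cases hc : c.val < q
  · left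
    refine ⟨Finset.univ.filter fun x => (p x).val = c.val, ?_, fun x hx y hy hxy => ?_,
      fun x hx y hy hxy => ?_⟩
    · have hlt : ∀ t : Fin m, t.val * q + c.val < n := fun t => by
        have := Nat.mul_le_mul_right q (Nat.succ_le_iff.2 t.isLt)
        rw [Nat.succ_mul] at this
        omega
      calc m = (Finset.univ : Finset (Fin m)).card := by simp
        _ ≤ _ := Finset.card_le_card_of_injOn (fun t => ⟨t.val * q + c.val, hlt t⟩)
          (fun t _ => by
            simp [hp, Nat.mul_add_mod_of_lt hc])
          (fun s _ t _ hst => by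
            have h1 := Fin.val_eq_of_eq hst
            dsimp only at h1
            exact Fin.ext (Nat.eq_of_mul_eq_mul_right hq (Nat.add_right_cancel h1)))
    · have hx' : (p x).val = c.val := (Finset.mem_filter.1 hx).2
      have hy' : (p y).val = c.val := (Finset.mem_filter.1 hy).2
      have hpe : p x = p y := Fin.ext (hx'.trans hy'.symm)
      refine ⟨hxy, Fin.ext ?_⟩
      rw [hκ_diag _ (by rw [Sym2.map_mk]; exact hpe), Sym2.map_mk, Sym2.inf_mk, ← hpe, inf_idem,
        hx']
    · have h1 := hκ_small _ c hc hxy.2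
      rw [Sym2.map_mk, Sym2.inf_mk] at h1
      rcases min_choice (p x) (p y) with h2 | h2
      · exact hx (Finset.mem_filter.2 ⟨Finset.mem_univ _, by rw [← h1]; exact congrArg _ h2.symm⟩)
      · exact hy (Finset.mem_filter.2 ⟨Finset.mem_univ _, by rw [← h1]; exact congrArg _ h2.symm⟩)
  · right
    obtain ⟨e, he⟩ : ∃ e, e = f ⟨c, not_lt.1 hc⟩ := ⟨_, rfl⟩
    obtain ⟨e, hediag⟩ := e
    induction e with
    | _ i j =>
      have hij : i ≠ j := hediag
      have hlt : ∀ (t : Fin m) (i : Fin q), t.val * q + i.val < n := fun t i => by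
        have := Nat.mul_le_mul_right q (Nat.succ_le_iff.2 t.isLt)
        rw [Nat.succ_mul] at this
        have := i.isLt
        omega
      let v : Fin q → Fin m → Fin n := fun i t => ⟨t.val * q + i.val, hlt t i⟩
      have hpv : ∀ i t, p (v i t) = i := fun i t =>
        Fin.ext (by simp [hp, v, Nat.mod_eq_of_lt i.isLt])
      have hvlevel : ∀ i t, (v i t).val / q < m := fun i t => by
        have h1 := Nat.mul_le_mul_right q (Nat.succ_le_iff.2 t.isLt)
        rw [Nat.succ_mul] at h1
        exact (Nat.div_lt_iff_lt_mul hq).2 (lt_of_lt_of_le (Nat.add_lt_add_left i.isLt _) h1)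
      have hv_surj : ∀ x : Fin n, x.val / q < m → ∃ t, x = v (p x) t := fun x hx =>
        ⟨⟨x.val / q, hx⟩, Fin.ext (Nat.div_add_mod' x.val q).symm⟩
      have hv_inj : ∀ i, Function.Injective (v i) := fun i s t hst => by
        have h1 := Fin.val_eq_of_eq hst
        exact Fin.ext (Nat.eq_of_mul_eq_mul_right hq (Nat.add_right_cancel h1))
      refine ⟨v i, v j, hv_inj i, hv_inj j, fun s t hst => hij ?_, fun x y => ?_⟩
      · rw [← hpv i s, hst, hpv]
      · have h1 : (colorClass κ c).Adj x y ↔ x ≠ y ∧ s(i, j) = s(p x, p y) ∧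
            (x.val / q < m ∧ y.val / q < m) := by
          have h2 := hκ_large s(x, y) ⟨c, not_lt.1 hc⟩
          refine and_congr Iff.rfl (h2.trans (and_congr ?_ ?_))
          · rw [← he, Sym2.map_mk]
          · simp
        rw [h1]
        constructor
        · rintro ⟨-, h2, hx, hy⟩
          obtain ⟨s, hs⟩ := hv_surj x hx
          obtain ⟨t, ht⟩ := hv_surj y hy
          rcases Sym2.eq_iff.1 h2 with ⟨rfl, rfl⟩ | ⟨rfl, rfl⟩
          · exact Or.inl ⟨s, t, hs, ht⟩
          · exact Or.inr ⟨t, s, hs, ht⟩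
        · have hne : ∀ s t, v i s ≠ v j t := fun s t hst => hij (by rw [← hpv i s, hst, hpv])
          rintro (⟨s, t, rfl, rfl⟩ | ⟨s, t, rfl, rfl⟩)
          · exact ⟨hne s t, by rw [hpv, hpv], hvlevel _ _, hvlevel _ _⟩
          · exact ⟨(hne s t).symm, by rw [hpv, hpv, Sym2.eq_swap], hvlevel _ _, hvlevel _ _⟩

theorem mul_le_sumUpper {β : GraphParameter}
    (hclique : ∀ {n : ℕ} {G : SimpleGraph (Fin n)} {U : Finset (Fin n)}, IsCoveringClique G U →
      U.card ≤ β n G + 1)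
    (hbiclique : ∀ {n m : ℕ} {G : SimpleGraph (Fin n)} {a b : Fin m → Fin n}, IsBiclique G a b →
      3 ≤ m → m ≤ β n G + 1) {q r n m : ℕ} (hq : 0 < q) (hqr : q ≤ r)
    (hr : r ≤ q + q.choose 2) (hm : m * q ≤ n) (hm3 : 3 ≤ m) :
    r * (m - 1) ≤ sumUpper β r n := by
  obtain ⟨G, hG, h⟩ := exists_decomposition_cliques_bicliques hq hqr hr hm
  refine le_trans ?_ (le_sumUpper β hG)
  calc r * (m - 1) = ∑ _i : Fin r, (m - 1) := by simp
    _ ≤ _ := Finset.sum_le_sum fun c _ => by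
      rcases h c with ⟨U, hU, hUc⟩ | ⟨a, b, hab⟩
      · have := hclique hUc; omega
      · have := hbiclique hab hm3; omega

/-! ### Asymptotics -/

/-- The positive part of `L - u n` is an error term valid for every `n`; the eventual bound by `v`
is needed only for its convergence. -/
theorem exists_error_le {u v : ℕ → ℝ} {L : ℝ} (hv : Tendsto v atTop (𝓝 L))
    (h : ∀ᶠ n in atTop, v n ≤ u n) :
    ∃ ε : ℕ → ℝ, Tendsto ε atTop (𝓝 0) ∧ ∀ n, L - ε n ≤ u n := by
  refine ⟨fun n => max 0 (L - u n), ?_, fun n => by have := le_max_right 0 (L - u n); linarith⟩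
  have h1 : Tendsto (fun n => max 0 (L - v n)) atTop (𝓝 0) := by
    have := (tendsto_const_nhds (x := (0 : ℝ))).max (hv.const_sub L)
    simpa using this
  refine tendsto_of_tendsto_of_tendsto_of_le_of_le' tendsto_const_nhds h1
    (Eventually.of_forall fun n => le_max_left _ _) ?_
  filter_upwards [h] with n hn
  exact max_le_max le_rfl (by linarith)

/-- The integer `⌈√(2r + 1/4) - 1/2⌉` is the least `q` with `r ≤ q (q + 1) / 2`. -/
theorem exists_nat_eq_ceil {r : ℕ} (hr : 2 ≤ r) :
    ∃ q : ℕ, ⌈√(2 * (r : ℝ) + 1 / 4) - 1 / 2⌉ = (q : ℤ) ∧ 0 < q ∧ q ≤ r ∧ r ≤ q + q.choose 2 := by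
  have hr2 : (2 : ℝ) ≤ r := by exact_mod_cast hr
  set t := √(2 * (r : ℝ) + 1 / 4) with ht
  have ht2 : t ^ 2 = 2 * r + 1 / 4 := Real.sq_sqrt (by positivity)
  have ht1 : 1 < t := Real.lt_sqrt_of_sq_lt (by linarith)
  have hpos : 0 < ⌈t - 1 / 2⌉ := Int.ceil_pos.2 (by linarith)
  obtain ⟨q, hq⟩ := Int.eq_ofNat_of_zero_le hpos.le
  have h1 : t - 1 / 2 ≤ q := by
    have := Int.le_ceil (t - 1 / 2)
    rw [hq] at this
    exact_mod_cast this
  have h2 : (q : ℝ) < t + 1 / 2 := by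
    have := Int.ceil_lt_add_one (t - 1 / 2)
    rw [hq] at this
    have h3 : (q : ℝ) < t - 1 / 2 + 1 := by exact_mod_cast this
    linarith
  have hq0 : 0 < q := by omega
  have hq1 : (1 : ℝ) ≤ q := by exact_mod_cast hq0
  -- Compare the squares of `q + 1 / 2` and `t`; likewise `q - 1 / 2 < t` for the next bound.
  have h3 : 2 * (r : ℝ) ≤ q * (q + 1) := by nlinarith
  have h4 : (q : ℝ) * (q - 1) < 2 * r := by nlinarith
  have h5 : 2 * r ≤ q * (q + 1) := by exact_mod_cast h3
  have h6 : q * (q - 1) < 2 * r := by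
    rw [← Nat.cast_pred hq0] at h4
    exact_mod_cast h4
  obtain ⟨s, rfl⟩ : ∃ s, q = s + 1 := ⟨q - 1, by omega⟩
  refine ⟨s + 1, hq, hq0, ?_, ?_⟩
  · rw [Nat.add_sub_cancel] at h6
    rcases s with _ | s
    · omega
    · nlinarith
  · rw [Nat.choose_two_right]
    have := Nat.div_mul_cancel (Nat.even_mul_pred_self (s + 1)).two_dvd
    rw [Nat.add_sub_cancel] at *
    nlinarith

theorem sumUpper_linear {r : ℕ} (hr : 2 ≤ r) {β : GraphParameter}
    (hβ : ∀ {n : ℕ} (G : SimpleGraph (Fin n)), β n G * (β n G - 1) ≤ 2 * n + adjPairs G)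
    (hclique : ∀ {n : ℕ} {G : SimpleGraph (Fin n)} {U : Finset (Fin n)}, IsCoveringClique G U →
      U.card ≤ β n G + 1)
    (hbiclique : ∀ {n m : ℕ} {G : SimpleGraph (Fin n)} {a b : Fin m → Fin n}, IsBiclique G a b →
      3 ≤ m → m ≤ β n G + 1) :
    ((fun n : ℕ => (sumUpper β r n : ℝ)) =Θ[atTop] (fun n : ℕ => (n : ℝ))) ∧
    ∃ ε δ : ℕ → ℝ, Tendsto ε atTop (𝓝 0) ∧ Tendsto δ atTop (𝓝 0) ∧
      ∀ n : ℕ, 3 ≤ n →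
        (r : ℝ) / ((⌈Real.sqrt (2 * (r : ℝ) + 1 / 4) - 1 / 2⌉ : ℤ) : ℝ) - ε n
            ≤ (sumUpper β r n : ℝ) / (n : ℝ) ∧
        (sumUpper β r n : ℝ) / (n : ℝ) ≤ Real.sqrt (r : ℝ) + δ n := by
  obtain ⟨q, hceil, hq, hqr, hrq⟩ := exists_nat_eq_ceil hr
  rw [hceil, Int.cast_natCast]
  have hq0 : (0 : ℝ) < q := by exact_mod_cast hq
  have hr0 : (0 : ℝ) < r := by positivity
  have hlow_lim : Tendsto (fun n : ℕ => (r : ℝ) / q - 2 * r * (1 / (n : ℝ))) atTop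
      (𝓝 ((r : ℝ) / q)) := by
    have := (tendsto_one_div_atTop_nhds_zero_nat (𝕜 := ℝ)).const_mul (2 * r : ℝ)
    simpa using this.const_sub ((r : ℝ) / q)
  -- The loss of `2` per graph comes from rounding `n / q` down and from the `- 1` in `m - 1`.
  have hlow : ∀ᶠ n : ℕ in atTop,
      (r : ℝ) / q - 2 * r * (1 / (n : ℝ)) ≤ (sumUpper β r n : ℝ) / n := by
    filter_upwards [eventually_ge_atTop (3 * q)] with n hn
    have hn0 : (0 : ℝ) < n := by
      have : 0 < n := by omega
      exact_mod_cast this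
    have hm3 : 3 ≤ n / q := (Nat.le_div_iff_mul_le hq).2 hn
    have h1 := mul_le_sumUpper hclique hbiclique hq hqr hrq (Nat.div_mul_le_self n q) hm3
    have h2 : (r : ℝ) * ((n / q : ℕ) - 1) ≤ sumUpper β r n := by
      rw [← Nat.cast_pred (by omega)]
      exact_mod_cast h1
    have h3 : (n : ℝ) / q - 1 ≤ (n / q : ℕ) := by
      have := Nat.lt_div_mul_add (a := n) hq
      rw [div_sub_one hq0.ne', div_le_iff₀ hq0]
      have : (n : ℝ) < (n / q : ℕ) * q + q := by exact_mod_cast this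
      linarith
    rw [le_div_iff₀ hn0]
    refine le_trans (le_of_eq ?_) (le_trans (mul_le_mul_of_nonneg_left
      (sub_le_sub_right h3 1) hr0.le) h2)
    field_simp
    ring
  have hup_lim := tendsto_sqrt_bound r
  have hup : ∀ n : ℕ, (sumUpper β r n : ℝ) / n ≤ (r + √r * √(2 * r * n + (n : ℝ) ^ 2)) / n :=
    fun n => div_le_div_of_nonneg_right (sumUpper_le_of_mul_le (by omega) hβ n) (Nat.cast_nonneg _)
  refine ⟨⟨?_, ?_⟩, ?_⟩
  · refine IsBigO.of_bound (√r + 1) ?_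
    filter_upwards [hup_lim.eventually_le_const (lt_add_one √(r : ℝ)), eventually_gt_atTop 0]
      with n h1 hn
    have hn0 : (0 : ℝ) < n := by exact_mod_cast hn
    rw [Real.norm_natCast, Real.norm_natCast, ← div_le_iff₀ hn0]
    exact (hup n).trans h1
  · refine IsBigO.of_bound (2 * q / r) ?_
    have h0 : (r : ℝ) / q / 2 < r / q := half_lt_self (by positivity)
    filter_upwards [hlow_lim.eventually_const_le h0, hlow, eventually_gt_atTop 0] with n h1 h2 hn
    have hn0 : (0 : ℝ) < n := by exact_mod_cast hn
    rw [Real.norm_natCast, Real.norm_natCast]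
    have h3 := h1.trans h2
    rw [le_div_iff₀ hn0] at h3
    calc (n : ℝ) = 2 * q / r * ((r : ℝ) / q / 2 * n) := by field_simp
      _ ≤ _ := by gcongr
  · obtain ⟨ε, hε, hε'⟩ := exists_error_le hlow_lim hlow
    -- The upper estimate is the lower one for the negated sequence.
    obtain ⟨δ, hδ, hδ'⟩ := exists_error_le hup_lim.neg (u := fun n => -((sumUpper β r n : ℝ) / n))
      (Eventually.of_forall fun n => neg_le_neg (hup n))
    exact ⟨ε, δ, hε, hδ, fun n _ => ⟨hε' n, by have := hδ' n; linarith⟩⟩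

end NG

theorem theorem1p1 (r : ℕ) (hr : 2 ≤ r) :
    (∀ β ∈ ({NG.treeWidth, NG.largeurArborescence, NG.pathWidth, NG.properPathWidth} :
          Set GraphParameter),
        Tendsto (fun n : ℕ => (NG.sumUpper β r n : ℝ) / (n : ℝ)) atTop (𝓝 (r : ℝ))) ∧
    (∀ β ∈ ({NG.hadwiger, NG.mu, NG.nu, NG.xi} : Set GraphParameter),
        ((fun n : ℕ => (NG.sumUpper β r n : ℝ)) =Θ[atTop] (fun n : ℕ => (n : ℝ))) ∧
        ∃ ε δ : ℕ → ℝ, Tendsto ε atTop (𝓝 0) ∧ Tendsto δ atTop (𝓝 0) ∧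
          ∀ n : ℕ, 3 ≤ n →
            (r : ℝ) / ((⌈Real.sqrt (2 * (r : ℝ) + 1 / 4) - 1 / 2⌉ : ℤ) : ℝ) - ε n
                ≤ (NG.sumUpper β r n : ℝ) / (n : ℝ) ∧
            (NG.sumUpper β r n : ℝ) / (n : ℝ) ≤ Real.sqrt (r : ℝ) + δ n) := by
  refine ⟨?_, ?_⟩
  · rintro β (rfl | rfl | rfl | rfl)
    · exact NG.tendsto_sumUpper_of_hasNoGap hr NG.treeWidth_bounds
    · exact NG.tendsto_sumUpper_of_hasNoGap hr NG.largeurArborescence_bounds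
    · exact NG.tendsto_sumUpper_of_hasNoGap hr NG.pathWidth_bounds
    · exact NG.tendsto_sumUpper_of_hasNoGap hr NG.properPathWidth_bounds
  · rintro β (rfl | rfl | rfl | rfl)
    · exact NG.sumUpper_linear hr NG.hadwiger_mul_le NG.IsCoveringClique.card_le_hadwiger
        fun h _ => h.le_hadwiger
    · exact NG.sumUpper_linear hr NG.mu_mul_le NG.IsCoveringClique.card_le_mu NG.IsBiclique.le_mu
    · exact NG.sumUpper_linear hr NG.nu_mul_le NG.IsCoveringClique.card_le_nu NG.IsBiclique.le_nu
    · exact NG.sumUpper_linear hr NG.xi_mul_le NG.IsCoveringClique.card_le_xi NG.IsBiclique.le_xi
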